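/- Call a finite $d$-regular graph $G$ an $\epsilon$-expander if every nontrivial eigenvalue of its adjacency matrix (that is, every eigenvalue other than one copy of $d$, the one belonging to the constant vector) has absolute value at most $(1-\epsilon)d$. For $S\subset\mathbb F_2^t$, let $\mathrm{Cay}(\mathbb F_2^t,S)$ be the Cayley graph on $\mathbb F_2^t$ with generating set $S$. For $r\ge 3$ let $\mathcal P$ be the family of all $I\subseteq\{1,\dots,r\}$ such that either $1\le |I|<r/2$, or $|I|=r/2$ and $1\in I$ (the latter only occurs for even $r$). For $S\subset\mathbb F_2^t$ let $\mathcal T$ be the set of tuples $\mathbf s=(s_I)_{I\in\mathcal P}$ of pairwise distinct elements of $S$, and for $x\in\mathbb F_2^t$ and $\mathbf s\in\mathcal T$ put $$e(x,\mathbf s)=\Bigl(x+\sum_{I\in\mathcal P,\ i\in I}s_I\Bigr)_{1\le i\le r}.$$ Let $H_{r,t,S}$ be the hypergraph with vertex set $\mathbb F_2^t$ in which $\{v_1,\dots,v_r\}$ is an edge if and only if $(v_1,\dots,v_r)=e(x,\mathbf s)$ for some $x\in\mathbb F_2^t$ and $\mathbf s\in\mathcal T$; under the assumption (b) below it is $r$-uniform.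 An $(r-1)$-edge of $H_{r,t,S}$ is an $(r-1)$-element subset of an edge. The walk graph $G_{\mathrm{walk}}(H_{r,t,S})$ has the $(r-1)$-edges as its vertices, and two distinct $(r-1)$-edges are adjacent if and only if they are contained in a common edge of $H_{r,t,S}$. **Theorem.** For every $r\ge 3$ there is a constant $c=c(r)>0$, depending only on $r$, such that the following holds for all $t$, all $\epsilon>0$ and all $S\subset\mathbb F_2^t$. Suppose that (a) $|S|\ge 2^{2r}$; (b) the sums $s_1+\dots+s_l$ are different for all choices of $0\le l\le 2^r$ and of sets $\{s_1,\dots,s_l\}\subset S$ of $l$ distinct elements; (c) $\mathrm{Cay}(\mathbb F_2^t,S)$ is an $\epsilon$-expander. Then the walk graph $G_{\mathrm{walk}}(H_{r,t,S})$ is regular and is a $c\epsilon$-expander. -/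

import Mathlib

namespace HypergraphExpander

/-! ### Spectral expansion of graphs -/

section Graph

variable {V : Type*} [Fintype V]

/-- `μ` is a nontrivial eigenvalue of the adjacency matrix of the (regular) graph `G`: it has an
eigenvector orthogonal to the constant vector, which spans the trivial eigendirection.
Equivalently, `μ` occurs in the list of eigenvalues, taken with multiplicity, after one copy of
the degree has been removed. -/
def IsNontrivialEigenvalue (G : SimpleGraph V) (μ : ℝ) : Prop :=
  open scoped Classical in
  ∃ v : V → ℝ, v ≠ 0 ∧ ∑ x, v x = 0 ∧ (G.adjMatrix ℝ).mulVec v = μ • v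

/-- `G` is an `ε`-expander: `G` is `d`-regular for some `d`, and every nontrivial eigenvalue of its
adjacency matrix has absolute value at most `(1 - ε) d`. -/
def IsExpander (G : SimpleGraph V) (ε : ℝ) : Prop :=
  open scoped Classical in
  ∃ d : ℕ, G.IsRegularOfDegree d ∧
    ∀ μ : ℝ, IsNontrivialEigenvalue G μ → |μ| ≤ (1 - ε) * d

end Graph

/-! ### Walk graphs of uniform hypergraphs -/

section Hypergraph

variable {V : Type*}

/-- `H` is `r`-uniform: all its edges have exactly `r` elements. -/
def IsUniform (H : Hypergraph V) (r : ℕ) : Prop :=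
  ∀ e ∈ H.edgeSet, e.ncard = r ∧ e.Finite

/-- The `k`-edges of a hypergraph: the `k`-element sets of vertices contained in an edge. -/
def KEdge (H : Hypergraph V) (k : ℕ) : Type _ :=
  {f : Set V // f.ncard = k ∧ f.Finite ∧ ∃ e ∈ H.edgeSet, f ⊆ e}

noncomputable instance [Finite V] (H : Hypergraph V) (k : ℕ) : Fintype (KEdge H k) :=
  @Fintype.ofFinite _ (inferInstanceAs (Finite (Subtype _)))

/-- The walk graph of an `r`-uniform hypergraph: its vertices are the `(r - 1)`-edges, and two
distinct `(r - 1)`-edges are adjacent if some `r`-edge contains both. -/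
def walkGraph (H : Hypergraph V) (r : ℕ) : SimpleGraph (KEdge H (r - 1)) where
  Adj f g := f ≠ g ∧ ∃ e ∈ H.edgeSet, f.1 ⊆ e ∧ g.1 ⊆ e
  symm := ⟨fun _ _ ⟨hne, e, he, hf, hg⟩ => ⟨hne.symm, e, he, hg, hf⟩⟩
  loopless := ⟨fun _ h => h.1 rfl⟩

end Hypergraph

/-! ### The construction -/

/-- All sums of at most `m` distinct elements of `S` are distinct: different subsets of `S` of size
at most `m` (possibly of different sizes, and including the empty set) have different sums. -/
def DistinctSums {t : ℕ} (m : ℕ) (S : Finset (Fin t → ZMod 2)) : Prop :=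
  ∀ A ⊆ S, ∀ B ⊆ S, A.card ≤ m → B.card ≤ m → ∑ a ∈ A, a = ∑ b ∈ B, b → A = B

/-- The lower half of the Boolean lattice on `r` points without the empty set: the sets `I` with
`1 ≤ |I| < r / 2` and, when `r` is even, also those with `|I| = r / 2` that contain the first
point. -/
def lowerHalf (r : ℕ) : Finset (Finset (Fin r)) :=
  Finset.univ.filter fun I =>
    1 ≤ I.card ∧ (2 * I.card < r ∨ (2 * I.card = r ∧ ∃ i ∈ I, (i : ℕ) = 0))

/-- The tuples `(s_I)` of distinct elements of `S`, indexed by the sets `I` of the lower half. -/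
structure DistinctTuple (r : ℕ) {t : ℕ} (S : Finset (Fin t → ZMod 2)) where
  /-- the coordinates -/
  coord : lowerHalf r → (Fin t → ZMod 2)
  coord_mem : ∀ I, coord I ∈ S
  coord_injective : Function.Injective coord

/-- The ordered `r`-tuple `e(x, s)`, with `i`-th entry `x + ∑_{I ∋ i} s_I`. -/
def edgeTuple {r t : ℕ} {S : Finset (Fin t → ZMod 2)} (x : Fin t → ZMod 2)
    (s : DistinctTuple r S) (i : Fin r) : Fin t → ZMod 2 :=
  x + ∑ I : lowerHalf r with i ∈ I.1, s.coord I

/-- The hypergraph `H_{r,t,S}` on the vertex set `𝔽₂ᵗ`, whose edges are the sets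
`{v₁, …, v_r}` with `(v₁, …, v_r) = e(x, s)` for some `x` and `s`. -/
def booleanHypergraph (r t : ℕ) (S : Finset (Fin t → ZMod 2)) : Hypergraph (Fin t → ZMod 2) where
  vertexSet := Set.univ
  edgeSet := {e | ∃ (x : Fin t → ZMod 2) (s : DistinctTuple r S), e = Set.range (edgeTuple x s)}
  subset_vertexSet_of_mem_edgeSet' := fun _ _ => Set.subset_univ _

/-- The entries of `e(x, s)` are distinct when the sums over small subsets of `S` are. -/
theorem edgeTuple_injective {r t : ℕ} (hr : 3 ≤ r) {S : Finset (Fin t → ZMod 2)}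
    (hS : DistinctSums (2 ^ r) S) (x : Fin t → ZMod 2) (s : DistinctTuple r S) :
    Function.Injective (edgeTuple x s) := by
  classical
  intro i j hij
  by_contra hne
  have hsum : ∀ k : Fin r, ∑ a ∈ (Finset.univ.filter fun I : lowerHalf r => k ∈ I.1).image s.coord,
      a = ∑ I : lowerHalf r with k ∈ I.1, s.coord I := fun k =>
    Finset.sum_image fun _ _ _ _ h => s.coord_injective h
  have hsub : ∀ k : Fin r,
      (Finset.univ.filter fun I : lowerHalf r => k ∈ I.1).image s.coord ⊆ S := by
    intro k a ha
    obtain ⟨I, -, rfl⟩ := Finset.mem_image.1 ha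
    exact s.coord_mem I
  have hcard : ∀ k : Fin r,
      ((Finset.univ.filter fun I : lowerHalf r => k ∈ I.1).image s.coord).card ≤ 2 ^ r := by
    intro k
    calc _ ≤ (Finset.univ : Finset (lowerHalf r)).card :=
          Finset.card_image_le.trans (Finset.card_le_card (Finset.filter_subset _ _))
      _ ≤ 2 ^ r := by
          rw [Finset.card_univ, Fintype.card_coe]
          exact (Finset.card_le_univ _).trans (by simp)
  have himg := hS _ (hsub i) _ (hsub j) (hcard i) (hcard j) (by
    rw [hsum, hsum]
    exact add_left_cancel hij)
  have hfil := Finset.image_injective s.coord_injective himg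
  have hmem : ({i} : Finset (Fin r)) ∈ lowerHalf r := by
    simp only [lowerHalf, Finset.mem_filter, Finset.mem_univ, Finset.card_singleton, true_and]
    omega
  have h1 : (⟨{i}, hmem⟩ : lowerHalf r) ∈
      Finset.univ.filter fun I : lowerHalf r => i ∈ I.1 := by simp
  rw [hfil] at h1
  simp at h1
  exact hne h1.symm

/-- The hypergraph `H_{r,t,S}` is `r`-uniform when the sums over small subsets of `S` are
distinct. -/
theorem booleanHypergraph_isUniform {r t : ℕ} (hr : 3 ≤ r) {S : Finset (Fin t → ZMod 2)}
    (hS : DistinctSums (2 ^ r) S) : IsUniform (booleanHypergraph r t S) r := by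
  rintro e ⟨x, s, rfl⟩
  refine ⟨?_, Set.finite_range _⟩
  rw [← Set.image_univ, Set.ncard_image_of_injective _ (edgeTuple_injective hr hS x s)]
  simp

end HypergraphExpander

namespace HypergraphExpander

/-! ### Walk graphs of uniform hypergraphs with constant codegree -/

section WalkGraph

open Finset
open scoped Classical

variable {V : Type*} [Finite V] {H : Hypergraph V} {r : ℕ}

/-! Every (r-1)-edge lies in the same number `D` of edges, and two distinct ones lie in at most one
common edge. So if `B` is the incidence operator between (r-1)-edges and edges, the adjacency
operator is `BᵀB - D` and the degree is `(r-1)D`. Hence no eigenvalue is below `-D ≥ -(r-1)D/2`.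
What remains is a Poincaré inequality: a function `f` on (r-1)-edges that varies little within each
edge is nearly constant.

The labels `s_I` really belong to the bipartitions `{I, Iᶜ}` (`IsEdgeTuple`), so the vertices of an
edge may be permuted, and the labels may be indexed by the nonempty sets avoiding index `0`, with
vertex `0` as base point. Given an embedding `ι` of the subsets of `Fin r` into `S`, pairs `(x, π)`
of a point and a permutation of `S` parametrize the edge tuples with fibres of constant size;
`card_labelStabilizer_mul_card_cofaces` gets the constant codegree from such counts.

Let `F i (x, π)` be the value of `f` on the face missing vertex `i`. Exchanging the labels of `I`
and `I ∪ {i}` moves at most vertex `i`, so it fixes `F i`, and `F 0`, being close to `F i` in L², is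
almost invariant. These transpositions connect the labels along the hypercube, so `F 0` is almost
invariant under `Perm S` (`length_le_of_hypercube`) and close to its mean over `π`. Exchanging the
label of `univ.erase 0` with the unused label `ι ∅`, while shifting `x` by their sum, fixes `F 0`
exactly (`permTuple_shift_mul_swap`). So the mean is almost invariant under two-step walks on the
Cayley graph, and expansion makes it almost constant (`exists_sum_sq_sub_le`). -/

/-- The edges of a hypergraph on a finite vertex set, as a finset. -/
noncomputable def edges (H : Hypergraph V) : Finset (Set V) :=
  (Set.toFinite H.edgeSet).toFinset

theorem mem_edges {e : Set V} : e ∈ edges H ↔ e ∈ H.edgeSet := by simp [edges]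

/-- The edges containing a given `k`-edge. -/
noncomputable def cofaces {k : ℕ} (g : KEdge H k) : Finset (Set V) :=
  (edges H).filter fun e => g.1 ⊆ e

theorem card_faces (hr : 1 ≤ r) (hH : IsUniform H r) {e : Set V} (he : e ∈ H.edgeSet) :
    #{g : KEdge H (r - 1) | g.1 ⊆ e} = r := by
  obtain ⟨hcard, hfin⟩ := hH e he
  have hmem : ∀ v ∈ e, (e \ {v}).ncard = r - 1 := fun v hv => by
    rw [Set.ncard_sdiff_singleton_of_mem hv, hcard]
  have hfin' : Fintype e := hfin.fintype
  have hr' : #(univ : Finset e) = r := by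
    rw [card_univ, ← hcard, Set.ncard_eq_toFinset_card' e, Set.toFinset_card]
  refine Eq.trans (Eq.symm ?_) hr'
  refine card_bij (fun v _ => (⟨e \ {v.1}, hmem v v.2, Set.toFinite _, e, he, Set.sdiff_subset⟩ :
    KEdge H (r - 1))) (fun v _ => mem_filter.2 ⟨mem_univ _, Set.sdiff_subset⟩) ?_ ?_
  · intro v _ w _ h
    have h' : e \ {v.1} = e \ {w.1} := congrArg Subtype.val h
    by_contra hne
    have : v.1 ∈ e \ {w.1} := ⟨v.2, fun h => hne (Subtype.ext h)⟩
    rw [← h'] at this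
    exact this.2 rfl
  · intro g hg
    have hg' : g.1 ⊆ e := (mem_filter.1 hg).2
    have hlt : g.1.ncard < e.ncard := by rw [g.2.1, hcard]; omega
    obtain ⟨v, hv, hvg⟩ := Set.exists_mem_notMem_of_ncard_lt_ncard hlt
    refine ⟨⟨v, hv⟩, mem_univ _, Subtype.ext ?_⟩
    have hsub : g.1 ⊆ e \ {v} := fun a ha => ⟨hg' ha, fun h => hvg (h ▸ ha)⟩
    exact (Set.eq_of_subset_of_ncard_le hsub (by rw [hmem v hv, g.2.1]) (Set.toFinite _)).symm

/-- Two distinct (r-1)-subsets have at least `r` points in their union, so they determine the edge.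
-/
theorem eq_union_of_faces (hr : 1 ≤ r) (hH : IsUniform H r) {g g' : KEdge H (r - 1)} (hne : g ≠ g')
    {e : Set V} (he : e ∈ H.edgeSet) (hg : g.1 ⊆ e) (hg' : g'.1 ⊆ e) : e = g.1 ∪ g'.1 := by
  refine (Set.eq_of_subset_of_ncard_le (Set.union_subset hg hg') ?_ (Set.toFinite _)).symm
  rw [(hH e he).1]
  have hss : g.1 ⊂ g.1 ∪ g'.1 := by
    refine Set.ssubset_iff_subset_ne.2 ⟨Set.subset_union_left, fun h => hne (Subtype.ext ?_)⟩
    refine (Set.eq_of_subset_of_ncard_le (h ▸ Set.subset_union_right) ?_ (Set.toFinite _)).symm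
    rw [g.2.1, g'.2.1]
  have := Set.ncard_lt_ncard hss (Set.toFinite _)
  rw [g.2.1] at this
  omega

theorem card_common_cofaces (hr : 1 ≤ r) (hH : IsUniform H r) {g g' : KEdge H (r - 1)}
    (hne : g ≠ g') :
    #{e ∈ edges H | g.1 ⊆ e ∧ g'.1 ⊆ e} = if (walkGraph H r).Adj g g' then 1 else 0 := by
  split_ifs with h
  · obtain ⟨-, e, he, hg, hg'⟩ := h
    refine card_eq_one.2 ⟨e, ?_⟩
    ext e'
    simp only [mem_filter, mem_edges, mem_singleton]
    constructor
    · rintro ⟨he', h1, h2⟩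
      rw [eq_union_of_faces hr hH hne he hg hg', eq_union_of_faces hr hH hne he' h1 h2]
    · rintro rfl
      exact ⟨he, hg, hg'⟩
  · refine card_eq_zero.2 (filter_eq_empty_iff.2 fun e he h' => h ⟨hne, e, ?_, h'⟩)
    exact mem_edges.1 he

/-- Summing over pairs of faces of edges amounts to summing over the diagonal and over the
adjacent pairs in the walk graph. -/
theorem sum_faces_faces (hr : 1 ≤ r) (hH : IsUniform H r) {D : ℕ}
    (hD : ∀ g : KEdge H (r - 1), #(cofaces g) = D) (φ : KEdge H (r - 1) → KEdge H (r - 1) → ℝ) :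
    ∑ e ∈ edges H, ∑ g : KEdge H (r - 1) with g.1 ⊆ e, ∑ g' : KEdge H (r - 1) with g'.1 ⊆ e,
      φ g g' = D * ∑ g, φ g g +
        ∑ g, ∑ g', if (walkGraph H r).Adj g g' then φ g g' else 0 := by
  have h1 : ∀ g g' : KEdge H (r - 1), (#{e ∈ edges H | g.1 ⊆ e ∧ g'.1 ⊆ e} : ℝ) * φ g g' =
      (if g = g' then D * φ g g else 0) +
        if (walkGraph H r).Adj g g' then φ g g' else 0 := by
    intro g g'
    by_cases hne : g = g'
    · subst hne
      have := hD g
      simp only [cofaces] at this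
      simp [this]
    · rw [card_common_cofaces hr hH hne]
      simp [hne]
  have h2 : ∀ g g' : KEdge H (r - 1), ∑ e ∈ edges H,
      (if g.1 ⊆ e then if g'.1 ⊆ e then φ g g' else 0 else 0) =
      (#{e ∈ edges H | g.1 ⊆ e ∧ g'.1 ⊆ e} : ℝ) * φ g g' := by
    intro g g'
    simp_rw [← ite_and]
    rw [← sum_filter, sum_const, nsmul_eq_mul]
  calc _ = ∑ e ∈ edges H, ∑ g : KEdge H (r - 1), ∑ g' : KEdge H (r - 1),
        (if g.1 ⊆ e then if g'.1 ⊆ e then φ g g' else 0 else 0) := by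
        refine sum_congr rfl fun e _ => ?_
        rw [sum_filter]
        refine sum_congr rfl fun g _ => ?_
        split_ifs
        · rw [sum_filter]
        · simp
    _ = ∑ g : KEdge H (r - 1), ∑ g' : KEdge H (r - 1), ∑ e ∈ edges H,
        (if g.1 ⊆ e then if g'.1 ⊆ e then φ g g' else 0 else 0) := by
        rw [sum_comm]
        exact sum_congr rfl fun g _ => sum_comm
    _ = _ := by
        simp_rw [h2, h1, sum_add_distrib]
        simp [mul_sum]

/-- Restrict `sum_faces_faces` to the row of `g`: each of the `D` cofaces contributes its `r` faces,
and the diagonal takes away one per coface. -/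
theorem sum_adj_const (hr : 1 ≤ r) (hH : IsUniform H r) {D : ℕ}
    (hD : ∀ g : KEdge H (r - 1), #(cofaces g) = D) (g : KEdge H (r - 1)) :
    (∑ g', if (walkGraph H r).Adj g g' then (1 : ℝ) else 0) = (r - 1) * D := by
  have h := sum_faces_faces hr hH hD fun a _ => if a = g then 1 else 0
  have hl : ∑ e ∈ edges H, ∑ a : KEdge H (r - 1) with a.1 ⊆ e,
      ∑ g' : KEdge H (r - 1) with g'.1 ⊆ e, (if a = g then (1 : ℝ) else 0) = r * D := by
    rw [← hD g, cofaces, card_filter, Nat.cast_sum, mul_sum]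
    refine sum_congr rfl fun e he => ?_
    simp only [sum_const, nsmul_eq_mul, card_faces hr hH (mem_edges.1 he), ← mul_sum]
    congr 1
    rw [sum_filter]
    simp only [← ite_and, and_comm (b := _ = g)]
    simp only [ite_and]
    simp
  rw [hl] at h
  have hrr : ∑ a : KEdge H (r - 1), ∑ g' : KEdge H (r - 1),
      (if (walkGraph H r).Adj a g' then if a = g then (1 : ℝ) else 0 else 0) =
      ∑ g', if (walkGraph H r).Adj g g' then (1 : ℝ) else 0 := by
    rw [Fintype.sum_eq_single g]
    · simp
    · intro a ha
      simp [ha]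
  rw [hrr] at h
  simp only [sum_ite_eq', mem_univ, if_true] at h
  linarith

theorem walkGraph_isRegular (hr : 1 ≤ r) (hH : IsUniform H r) {D : ℕ}
    (hD : ∀ g : KEdge H (r - 1), #(cofaces g) = D) :
    (walkGraph H r).IsRegularOfDegree ((r - 1) * D) := by
  intro g
  have h := sum_adj_const hr hH hD g
  rw [sum_boole] at h
  have h2 : ((walkGraph H r).degree g : ℝ) = ((r - 1) * D : ℕ) := by
    rw [← SimpleGraph.card_neighborFinset_eq_degree, SimpleGraph.neighborFinset_eq_filter, h]
    push_cast [Nat.cast_sub hr]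
    ring
  exact_mod_cast h2

variable {D : ℕ} {f : KEdge H (r - 1) → ℝ} {μ : ℝ}

/-- The quadratic form of `BᵀB`; its nonnegativity will give `μ ≥ -D`. -/
theorem sum_sq_sum_faces (hr : 1 ≤ r) (hH : IsUniform H r)
    (hD : ∀ g : KEdge H (r - 1), #(cofaces g) = D)
    (hf : ((walkGraph H r).adjMatrix ℝ).mulVec f = μ • f) :
    ∑ e ∈ edges H, (∑ g : KEdge H (r - 1) with g.1 ⊆ e, f g) ^ 2 = (D + μ) * ∑ g, f g ^ 2 := by
  have h := sum_faces_faces hr hH hD fun a b => f a * f b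
  have h2 : ∀ g, (∑ g', if (walkGraph H r).Adj g g' then f g * f g' else 0) = μ * f g ^ 2 := by
    intro g
    have := congrFun hf g
    simp only [Matrix.mulVec, dotProduct, SimpleGraph.adjMatrix_apply, ite_mul, one_mul, zero_mul,
      Pi.smul_apply, smul_eq_mul] at this
    rw [sq, ← mul_assoc, mul_right_comm, ← this, mul_comm, mul_sum]
    simp
  simp_rw [h2, ← mul_sum, ← sum_mul] at h
  simp_rw [sq] at h ⊢
  rw [h]
  ring

/-- Twice the Laplacian form: an upper bound on the norm of `f` by this variation becomes an upper
bound on `μ`. -/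
theorem sum_sq_sub_faces (hr : 1 ≤ r) (hH : IsUniform H r)
    (hD : ∀ g : KEdge H (r - 1), #(cofaces g) = D)
    (hf : ((walkGraph H r).adjMatrix ℝ).mulVec f = μ • f) :
    ∑ e ∈ edges H, ∑ g : KEdge H (r - 1) with g.1 ⊆ e, ∑ g' : KEdge H (r - 1) with g'.1 ⊆ e,
      (f g - f g') ^ 2 = 2 * ((r - 1) * D - μ) * ∑ g, f g ^ 2 := by
  have key : ∀ e ∈ edges H, ∑ g : KEdge H (r - 1) with g.1 ⊆ e,
      ∑ g' : KEdge H (r - 1) with g'.1 ⊆ e, (f g - f g') ^ 2 =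
      2 * r * (∑ g : KEdge H (r - 1) with g.1 ⊆ e, f g ^ 2) -
        2 * (∑ g : KEdge H (r - 1) with g.1 ⊆ e, f g) ^ 2 := by
    intro e he
    simp only [sub_sq, sum_add_distrib, sum_sub_distrib, sum_const, nsmul_eq_mul,
      card_faces hr hH (mem_edges.1 he), ← mul_sum, ← sum_mul]
    ring
  have h1 : ∑ e ∈ edges H, ∑ g : KEdge H (r - 1) with g.1 ⊆ e, f g ^ 2 = D * ∑ g, f g ^ 2 := by
    simp_rw [sum_filter]
    rw [sum_comm, mul_sum]
    refine sum_congr rfl fun g _ => ?_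
    rw [← sum_filter, sum_const, nsmul_eq_mul, ← hD g, cofaces]
  rw [sum_congr rfl key, sum_sub_distrib, ← mul_sum, ← mul_sum, h1, sum_sq_sum_faces hr hH hD hf]
  ring

end WalkGraph

/-! ### The spectral gap of Cayley graphs of `𝔽₂ᵗ` -/

section Cayley

open Finset
open scoped Classical

/-- A symmetric operator all of whose eigenvalues are bounded by `c` has norm at most `c`. -/
theorem norm_apply_le_of_eigenvalues {E : Type*} [NormedAddCommGroup E] [InnerProductSpace ℝ E]
    [FiniteDimensional ℝ E] {T : E →ₗ[ℝ] E} (hT : T.IsSymmetric) {c : ℝ}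
    (hc : ∀ (μ : ℝ) (v : E), v ≠ 0 → T v = μ • v → |μ| ≤ c) (x : E) : ‖T x‖ ≤ c * ‖x‖ := by
  rcases eq_or_ne x 0 with rfl | hx
  · simp
  set b := hT.eigenvectorBasis rfl
  have hev : ∀ i, |hT.eigenvalues rfl i| ≤ c := fun i =>
    hc _ (b i) (b.orthonormal.ne_zero i) (hT.apply_eigenvectorBasis rfl i)
  have hc0 : 0 ≤ c := by
    have : Nontrivial E := ⟨x, 0, hx⟩
    exact (abs_nonneg _).trans (hev ⟨0, Module.finrank_pos⟩)
  refine le_of_sq_le_sq ?_ (by positivity)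
  rw [mul_pow, ← b.repr.norm_map, ← b.repr.norm_map x, EuclideanSpace.norm_sq_eq,
    EuclideanSpace.norm_sq_eq, mul_sum]
  refine sum_le_sum fun i _ => ?_
  rw [hT.eigenvectorBasis_apply_self_apply, norm_mul, mul_pow]
  gcongr
  exact hev i

/-- On functions of mean zero, the adjacency operator of a graph is bounded by its largest
nontrivial eigenvalue. -/
theorem sqrt_sum_sq_adj_le {V : Type*} [Fintype V] {G : SimpleGraph V} {d : ℕ}
    (hG : G.IsRegularOfDegree d) {c : ℝ} (hc : ∀ μ, IsNontrivialEigenvalue G μ → |μ| ≤ c)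
    (h : V → ℝ) (hh : ∑ x, h x = 0) :
    √(∑ x, ((G.adjMatrix ℝ).mulVec h x) ^ 2) ≤ c * √(∑ x, h x ^ 2) := by
  let E := EuclideanSpace ℝ V
  -- Regularity makes the mean-zero subspace invariant, and eigenvectors in it are the nontrivial
  -- ones, so the spectral bound applies to the restriction.
  let K : Submodule ℝ E :=
    { carrier := {f | ∑ x, f x = 0}
      add_mem' := fun {a b} ha hb => by
        change ∑ x, a x = 0 at ha
        change ∑ x, b x = 0 at hb
        change ∑ x, (a x + b x) = 0
        rw [sum_add_distrib, ha, hb, add_zero]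
      zero_mem' := by simp
      smul_mem' := fun a f hf => by
        change ∑ x, f x = 0 at hf
        change ∑ x, a * f x = 0
        rw [← mul_sum, hf, mul_zero] }
  let T : E →ₗ[ℝ] E := (G.adjMatrix ℝ).toEuclideanLin
  have hTapp : ∀ (f : E) x, T f x = (G.adjMatrix ℝ).mulVec f x := fun f x => rfl
  have hT : T.IsSymmetric := by
    rw [Matrix.isSymmetric_toEuclideanLin_iff]
    ext i j
    simp [G.adj_comm]
  have hsum : ∀ f : V → ℝ, ∑ x, (G.adjMatrix ℝ).mulVec f x = d * ∑ x, f x := by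
    intro f
    simp only [Matrix.mulVec, dotProduct]
    rw [sum_comm, mul_sum]
    refine sum_congr rfl fun y _ => ?_
    rw [← sum_mul, ← hG y, ← SimpleGraph.card_neighborFinset_eq_degree,
      SimpleGraph.neighborFinset_eq_filter, card_filter]
    simp [SimpleGraph.adjMatrix_apply, G.adj_comm]
  have hTK : ∀ f ∈ K, T f ∈ K := by
    intro f hf
    have hf' : ∑ x, f x = 0 := hf
    change ∑ x, T f x = 0
    simp only [hTapp, hsum, hf', mul_zero]
  have hTK' := hT.restrict_invariant hTK
  have hcK : ∀ (μ : ℝ) (v : K), v ≠ 0 → T.restrict hTK v = μ • v → |μ| ≤ c := by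
    intro μ v hv hev
    have hev' : T v.1 = μ • v.1 := congrArg Subtype.val hev
    refine hc μ ⟨v.1.ofLp, ?_, v.2, ?_⟩
    · intro h0
      exact hv (Subtype.ext ((WithLp.ofLp_eq_zero 2).1 h0))
    · ext x
      exact congrArg (fun u : E => u x) hev'
  have hle : ‖T (WithLp.toLp 2 h)‖ ≤ c * ‖(WithLp.toLp 2 h : E)‖ :=
    norm_apply_le_of_eigenvalues hTK' hcK ⟨WithLp.toLp 2 h, hh⟩
  rw [EuclideanSpace.norm_eq (T _), EuclideanSpace.norm_eq] at hle
  simpa only [hTapp, Real.norm_eq_abs, sq_abs] using hle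

variable {V : Type*} [AddCommGroup V] [Module (ZMod 2) V] [Fintype V] {S : Finset V}

theorem adjMatrix_addCayley_mulVec {inst : DecidableRel (SimpleGraph.addCayley (S : Set V)).Adj}
    (h0 : 0 ∉ S) (h : V → ℝ) (x : V) :
    ((SimpleGraph.addCayley (S : Set V)).adjMatrix ℝ).mulVec h x =
      ∑ a ∈ S, h (x + a) := by
  have hadj : ∀ y, (SimpleGraph.addCayley (S : Set V)).Adj x y ↔ x + y ∈ S := by
    intro y
    rw [SimpleGraph.addCayley_adj']
    constructor
    · rintro ⟨-, a, ha, rfl | rfl⟩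
      · rwa [← add_assoc, ZModModule.add_self, zero_add]
      · rwa [add_right_comm, ZModModule.add_self, zero_add]
    · intro hxy
      refine ⟨?_, x + y, hxy, Or.inl ?_⟩
      · rintro rfl
        rw [ZModModule.add_self] at hxy
        exact h0 hxy
      · rw [← add_assoc, ZModModule.add_self, zero_add]
  simp only [Matrix.mulVec, dotProduct, SimpleGraph.adjMatrix_apply, hadj, ite_mul, one_mul,
    zero_mul]
  rw [← Equiv.sum_comp (Equiv.addLeft x)]
  simp only [Equiv.coe_addLeft, ← add_assoc, ZModModule.add_self, zero_add]
  rw [← sum_filter, filter_mem_eq_inter, univ_inter]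

theorem degree_addCayley {_ : (SimpleGraph.addCayley (S : Set V)).LocallyFinite} (h0 : 0 ∉ S) {d : ℕ}
    (hd : (SimpleGraph.addCayley (S : Set V)).IsRegularOfDegree d) : d = #S := by
  have h := adjMatrix_addCayley_mulVec (inst := inferInstance) h0 (fun _ => 1) 0
  rw [show (fun _ => 1 : V → ℝ) = Function.const V 1 from rfl,
    SimpleGraph.adjMatrix_mulVec_const_apply_of_regular (d := d) fun v => by convert hd v] at h
  simpa using h

variable {ε : ℝ}

theorem sqrt_sum_sq_le_of_isExpander (h0 : 0 ∉ S)
    (hS : IsExpander (SimpleGraph.addCayley (S : Set V)) ε)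
    (h : V → ℝ) (hh : ∑ x, h x = 0) :
    √(∑ x, (∑ a ∈ S, h (x + a)) ^ 2) ≤ (1 - ε) * #S * √(∑ x, h x ^ 2) := by
  obtain ⟨d, hd, hev⟩ := hS
  have := sqrt_sum_sq_adj_le hd hev h hh
  rw [← degree_addCayley h0 hd]
  simp only [adjMatrix_addCayley_mulVec h0] at this
  exact this

/-- Test the norm bound on a difference of two point masses: a negative factor `1 - ε` would make a
norm negative. -/
theorem le_one_of_isExpander (h0 : 0 ∉ S) (hne : S.Nonempty)
    (hS : IsExpander (SimpleGraph.addCayley (S : Set V)) ε) : ε ≤ 1 := by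
  obtain ⟨a, ha⟩ := hne
  have ha0 : a ≠ 0 := fun h => h0 (h ▸ ha)
  set h : V → ℝ := Pi.single 0 1 - Pi.single a 1 with hdef
  have hh : ∑ x, h x = 0 := by simp [hdef, sum_sub_distrib]
  have hle := sqrt_sum_sq_le_of_isExpander h0 hS h hh
  have hpos : 0 < √(∑ x, h x ^ 2) := by
    refine Real.sqrt_pos.2 (sum_pos' (fun x _ => sq_nonneg _) ⟨0, mem_univ _, ?_⟩)
    simp [hdef, ha0.symm]
  have hS : (0 : ℝ) < #S := by exact_mod_cast card_pos.2 ⟨a, ha⟩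
  have h1 : 0 ≤ (1 - ε) * #S := nonneg_of_mul_nonneg_left ((Real.sqrt_nonneg _).trans hle) hpos
  have h2 := nonneg_of_mul_nonneg_left h1 hS
  linarith

/-- The Poincaré inequality for the two-step walk on the Cayley graph. -/
theorem sum_sq_shift_ge_of_isExpander (h0 : 0 ∉ S) (hne : S.Nonempty) (hε : 0 ≤ ε)
    (hS : IsExpander (SimpleGraph.addCayley (S : Set V)) ε)
    (h : V → ℝ) (hh : ∑ x, h x = 0) :
    2 * ε * (#S : ℝ) ^ 2 * ∑ x, h x ^ 2 ≤
      ∑ a ∈ S, ∑ b ∈ S, ∑ x, (h (x + a + b) - h x) ^ 2 := by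
  have hε1 := le_one_of_isExpander h0 hne hS
  have hle := sqrt_sum_sq_le_of_isExpander h0 hS h hh
  have hle2 : ∑ x, (∑ a ∈ S, h (x + a)) ^ 2 ≤ (1 - ε) ^ 2 * (#S : ℝ) ^ 2 * ∑ x, h x ^ 2 := by
    have := pow_le_pow_left₀ (Real.sqrt_nonneg _) hle 2
    rwa [Real.sq_sqrt (sum_nonneg fun _ _ => sq_nonneg _), mul_pow, mul_pow,
      Real.sq_sqrt (sum_nonneg fun _ _ => sq_nonneg _)] at this
  have hcross : ∑ a ∈ S, ∑ b ∈ S, ∑ x, h (x + a + b) * h x =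
      ∑ x, (∑ a ∈ S, h (x + a)) ^ 2 := by
    have h1 : ∀ a b, ∑ x, h (x + a + b) * h x = ∑ x, h (x + b) * h (x + a) := by
      intro a b
      rw [← Equiv.sum_comp (Equiv.addRight a)]
      refine sum_congr rfl fun x _ => ?_
      simp only [Equiv.coe_addRight]
      rw [add_assoc x a a, ZModModule.add_self, add_zero]
    simp_rw [h1, sq, sum_mul_sum]
    rw [sum_comm]
    simp_rw [fun b => sum_comm (s := S) (t := univ) (f := fun a x => h (x + b) * h (x + a))]
    rw [sum_comm]
  have hsq : ∀ a b, ∑ x, (h (x + a + b) - h x) ^ 2 =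
      2 * ∑ x, h x ^ 2 - 2 * ∑ x, h (x + a + b) * h x := by
    intro a b
    have : ∑ x, h (x + a + b) ^ 2 = ∑ x, h x ^ 2 := by
      rw [← Equiv.sum_comp (Equiv.addRight (a + b)) (fun x => h x ^ 2)]
      simp only [Equiv.coe_addRight, add_assoc]
    simp_rw [sub_sq, sum_add_distrib, sum_sub_distrib, this, mul_assoc, ← mul_sum]
    ring
  simp_rw [hsq, sum_sub_distrib, ← mul_sum, hcross, sum_const, nsmul_eq_mul]
  have hN : 0 ≤ ∑ x, h x ^ 2 := sum_nonneg fun _ _ => sq_nonneg _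
  -- `1 - (1 - ε)² = ε + ε(1 - ε)`, and the last term is dropped.
  have h3 : 0 ≤ ε * (1 - ε) * ((#S : ℝ) ^ 2 * ∑ x, h x ^ 2) :=
    mul_nonneg (mul_nonneg hε (by linarith)) (by positivity)
  nlinarith

end Cayley

/-! ### Half systems and the symmetric description of edges -/

section HalfSystem

open Finset

variable {r : ℕ} {V : Type*} [AddCommGroup V]

/-- A half system contains exactly one of `I` and `Iᶜ` for every nontrivial `I`, and neither `∅`
nor the whole set. -/
structure IsHalfSystem (A : Finset (Finset (Fin r))) : Prop where
  empty_notMem : ∅ ∉ A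
  univ_notMem : univ ∉ A
  mem_iff : ∀ I, I ≠ ∅ → I ≠ univ → (I ∈ A ↔ Iᶜ ∉ A)

/-- The tuple with entries `x + ∑_{I ∈ A, i ∈ I} s_I`. -/
def halfTuple (A : Finset (Finset (Fin r))) (x : V) (s : Finset (Fin r) → V) (i : Fin r) : V :=
  x + ∑ I ∈ A with i ∈ I, s I

/-- `v` is the tuple of vertices of an edge: the differences of its entries are sums of distinct
elements of `S` labelled by the nontrivial bipartitions separating the two indices. -/
def IsEdgeTuple (S : Finset V) (v : Fin r → V) : Prop :=
  ∃ s : Finset (Fin r) → V, (∀ I, I ≠ ∅ → I ≠ univ → s I ∈ S) ∧ (∀ I, s Iᶜ = s I) ∧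
    (∀ I J, I ≠ ∅ → I ≠ univ → J ≠ ∅ → J ≠ univ → s I = s J → I = J ∨ I = Jᶜ) ∧
    ∀ i j, v i + v j = ∑ I with i ∈ I ∧ j ∉ I, s I

theorem sum_compl_filter (s : Finset (Fin r) → V) (p : Finset (Fin r) → Prop) [DecidablePred p]
    (hs : ∀ I, s Iᶜ = s I) : ∑ I with p Iᶜ, s I = ∑ I with p I, s I := by
  rw [sum_filter, sum_filter, ← Equiv.sum_comp (Function.Involutive.toPerm _ compl_involutive)]
  simp [hs]

/-- In characteristic two the sets containing both indices cancel. Of a separating set and its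
complement exactly one is in `A`, and both carry the same label. -/
theorem IsHalfSystem.sum_add_sum [Module (ZMod 2) V] {A : Finset (Finset (Fin r))}
    (hA : IsHalfSystem A) {s : Finset (Fin r) → V} (hs : ∀ I, s Iᶜ = s I) (i j : Fin r) :
    ∑ I ∈ A with i ∈ I, s I + ∑ I ∈ A with j ∈ I, s I = ∑ I with i ∈ I ∧ j ∉ I, s I := by
  have h1 : ∑ I with i ∈ I ∧ j ∉ I, s I =
      ∑ I with (i ∈ I ∧ j ∉ I) ∧ I ∈ A, s I + ∑ I with (j ∈ I ∧ i ∉ I) ∧ I ∈ A, s I := by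
    rw [← sum_filter_add_sum_filter_not _ (· ∈ A), filter_filter, filter_filter]
    congr 1
    rw [← sum_compl_filter s (fun I => (j ∈ I ∧ i ∉ I) ∧ I ∈ A) hs]
    refine sum_congr (filter_congr fun I _ => ?_) fun _ _ => rfl
    simp only [mem_compl, not_not]
    constructor
    · rintro ⟨⟨hi, hj⟩, hI⟩
      refine ⟨⟨hj, hi⟩, ?_⟩
      have := hA.mem_iff I (by rintro rfl; simp at hi) (by rintro rfl; simp at hj)
      tauto
    · rintro ⟨⟨hj, hi⟩, hI⟩
      refine ⟨⟨hi, hj⟩, ?_⟩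
      have := hA.mem_iff I (by rintro rfl; simp at hi) (by rintro rfl; simp at hj)
      tauto
  have h2 : ∀ k, ∑ I ∈ A with k ∈ I, s I = ∑ I, if k ∈ I ∧ I ∈ A then s I else 0 := by
    intro k
    rw [← sum_filter]
    exact sum_congr (by ext; simp [and_comm]) fun _ _ => rfl
  rw [h1, h2, h2, sum_filter, sum_filter, ← sum_add_distrib, ← sum_add_distrib]
  refine sum_congr rfl fun I _ => ?_
  by_cases hi : i ∈ I <;> by_cases hj : j ∈ I <;> by_cases hI : I ∈ A <;>
    simp [hi, hj, hI, ZModModule.add_self]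

theorem IsHalfSystem.isEdgeTuple [Module (ZMod 2) V] {S : Finset V} {A : Finset (Finset (Fin r))}
    (hA : IsHalfSystem A) (x : V) {s : Finset (Fin r) → V} (hs : ∀ I ∈ A, s I ∈ S)
    (hinj : Set.InjOn s A) : IsEdgeTuple S (halfTuple A x s) := by
  have hcompl : ∀ I, I ≠ ∅ → I ≠ univ → I ∉ A → Iᶜ ∈ A := fun I h1 h2 h => by
    by_contra h'
    exact h ((hA.mem_iff I h1 h2).2 h')
  have hmem : ∀ I ∈ A, Iᶜ ∉ A := fun I hI => by
    refine (hA.mem_iff I ?_ ?_).1 hI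
    · rintro rfl
      exact hA.empty_notMem hI
    · rintro rfl
      exact hA.univ_notMem hI
  -- The default `0` is reached only at `∅` and `univ`, whose labels are not constrained.
  set s' : Finset (Fin r) → V := fun I => if I ∈ A then s I else if Iᶜ ∈ A then s Iᶜ else 0
    with hs'
  have hs'A : ∀ I ∈ A, s' I = s I := fun I hI => by simp [hs', hI]
  have hsymm : ∀ I, s' Iᶜ = s' I := by
    intro I
    by_cases h1 : I ∈ A
    · simp [hs', h1, hmem I h1]
    · by_cases h2 : Iᶜ ∈ A <;> simp [hs', h1, h2]
  have hrep : ∀ I, I ≠ ∅ → I ≠ univ → ∃ J ∈ A, (J = I ∨ J = Iᶜ) ∧ s' I = s J := by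
    intro I h1 h2
    by_cases h : I ∈ A
    · exact ⟨I, h, Or.inl rfl, hs'A I h⟩
    · have h' := hcompl I h1 h2 h
      exact ⟨Iᶜ, h', Or.inr rfl, by rw [← hsymm, hs'A _ h']⟩
  refine ⟨s', ?_, hsymm, ?_, ?_⟩
  · intro I h1 h2
    obtain ⟨J, hJ, -, h⟩ := hrep I h1 h2
    exact h ▸ hs J hJ
  · intro I J hI hI' hJ hJ' h
    obtain ⟨K, hK, hKI, h1⟩ := hrep I hI hI'
    obtain ⟨L, hL, hLJ, h2⟩ := hrep J hJ hJ'
    have hKL : K = L := hinj hK hL (by rw [← h1, ← h2, h])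
    subst hKL
    rcases hKI with h3 | h3 <;> rcases hLJ with h4 | h4
    · exact Or.inl (h3.symm.trans h4)
    · exact Or.inr (h3.symm.trans h4)
    · exact Or.inr (by rw [← h4, h3, compl_compl])
    · exact Or.inl (compl_injective (h3.symm.trans h4))
  · intro i j
    rw [← hA.sum_add_sum hsymm i j]
    have h1 : ∀ k, ∑ I ∈ A with k ∈ I, s' I = ∑ I ∈ A with k ∈ I, s I := fun k =>
      sum_congr rfl fun I hI => hs'A I (mem_filter.1 hI).1
    rw [h1, h1, halfTuple, halfTuple, add_add_add_comm, ZModModule.add_self, zero_add]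

theorem IsEdgeTuple.exists_halfTuple [NeZero r] [Module (ZMod 2) V] {S : Finset V} {v : Fin r → V}
    (hv : IsEdgeTuple S v) {A : Finset (Finset (Fin r))} (hA : IsHalfSystem A) :
    ∃ (x : V) (s : Finset (Fin r) → V), (∀ I ∈ A, s I ∈ S) ∧ Set.InjOn s A ∧
      halfTuple A x s = v := by
  obtain ⟨s, hS, hsymm, hinj, hsum⟩ := hv
  have hA1 : ∀ I ∈ A, I ≠ ∅ := fun I hI h => hA.empty_notMem (h ▸ hI)
  have hA2 : ∀ I ∈ A, I ≠ univ := fun I hI h => hA.univ_notMem (h ▸ hI)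
  refine ⟨v 0 + ∑ I ∈ A with 0 ∈ I, s I, s, fun I hI => hS I (hA1 I hI) (hA2 I hI), ?_, ?_⟩
  · intro I hI J hJ h
    refine (hinj I J (hA1 I hI) (hA2 I hI) (hA1 J hJ) (hA2 J hJ) h).resolve_right fun h' => ?_
    exact (hA.mem_iff I (hA1 I hI) (hA2 I hI)).1 hI (by rw [h', compl_compl]; exact hJ)
  · funext j
    rw [halfTuple, add_assoc, hA.sum_add_sum hsymm, ← hsum, ← add_assoc, ZModModule.add_self,
      zero_add]

/-- A half system need not be invariant under permuting indices, but the family of bipartitions is.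
This lets any vertex of an edge take position `0`. -/
theorem IsEdgeTuple.comp_perm {S : Finset V} {v : Fin r → V} (hv : IsEdgeTuple S v)
    (σ : Equiv.Perm (Fin r)) : IsEdgeTuple S (v ∘ σ) := by
  obtain ⟨s, hS, hsymm, hinj, hsum⟩ := hv
  have hcompl : ∀ I : Finset (Fin r), Iᶜ.map σ.toEmbedding = (I.map σ.toEmbedding)ᶜ := by
    intro I
    ext a
    simp [mem_map_equiv]
  have hmapinj := map_injective σ.toEmbedding
  have huniv : ∀ I : Finset (Fin r), I ≠ univ → I.map σ.toEmbedding ≠ univ := by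
    intro I hI h
    exact hI (hmapinj (by rw [h, map_univ_equiv]))
  have hempty : ∀ I : Finset (Fin r), I ≠ ∅ → I.map σ.toEmbedding ≠ ∅ := by
    intro I hI h
    exact hI (map_eq_empty.1 h)
  refine ⟨fun I => s (I.map σ.toEmbedding), fun I h1 h2 => hS _ (hempty I h1) (huniv I h2),
    fun I => ?_, fun I J h1 h2 h3 h4 h => ?_, fun i j => ?_⟩
  · simp only [hcompl, hsymm]
  · rcases hinj _ _ (hempty I h1) (huniv I h2) (hempty J h3) (huniv J h4) h with h | h
    · exact Or.inl (hmapinj h)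
    · exact Or.inr (hmapinj (by rw [h, hcompl]))
  · rw [Function.comp_apply, Function.comp_apply, hsum, sum_filter, sum_filter,
      ← Equiv.sum_comp σ.finsetCongr]
    refine sum_congr rfl fun I _ => ?_
    simp

theorem isHalfSystem_lowerHalf [NeZero r] : IsHalfSystem (lowerHalf r) where
  empty_notMem := by simp [lowerHalf]
  univ_notMem := by
    have := NeZero.pos r
    simp [lowerHalf]
    omega
  mem_iff I h1 h2 := by
    have hI : 1 ≤ #I := card_pos.2 (nonempty_iff_ne_empty.2 h1)
    have hI' : 1 ≤ #Iᶜ := card_pos.2 (nonempty_iff_ne_empty.2 (by simpa using h2))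
    have hsum := card_add_card_compl I
    rw [Fintype.card_fin] at hsum
    have hz : ∀ J : Finset (Fin r), (∃ i ∈ J, (i : ℕ) = 0) ↔ (0 : Fin r) ∈ J := by
      intro J
      constructor
      · rintro ⟨i, hi, h⟩
        have : i = 0 := Fin.ext (by simpa using h)
        exact this ▸ hi
      · exact fun h => ⟨0, h, by simp⟩
    simp only [lowerHalf, mem_filter, mem_univ, true_and, hz, mem_compl]
    by_cases h0 : (0 : Fin r) ∈ I <;> 
      simp only [h0, not_true, not_false_eq_true, and_true, and_false, or_false] <;> omega

/-- The nonempty sets avoiding the first point. -/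
def avoidZero (r : ℕ) [NeZero r] : Finset (Finset (Fin r)) :=
  univ.filter fun I => I.Nonempty ∧ 0 ∉ I

theorem mem_avoidZero [NeZero r] {I : Finset (Fin r)} :
    I ∈ avoidZero r ↔ I.Nonempty ∧ 0 ∉ I := by simp [avoidZero]

theorem isHalfSystem_avoidZero [NeZero r] : IsHalfSystem (avoidZero r) where
  empty_notMem := by simp [avoidZero]
  univ_notMem := by simp [avoidZero]
  mem_iff I h1 h2 := by
    have h3 : Iᶜ.Nonempty := nonempty_iff_ne_empty.2 (by simpa using h2)
    simp [mem_avoidZero, h3, nonempty_iff_ne_empty.2 h1]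

theorem mem_edgeSet_booleanHypergraph [NeZero r] {t : ℕ} {S : Finset (Fin t → ZMod 2)}
    {e : Set (Fin t → ZMod 2)} :
    e ∈ (booleanHypergraph r t S).edgeSet ↔ ∃ v, IsEdgeTuple S v ∧ e = Set.range (v : Fin r → _) := by
  have hsum : ∀ (s : Finset (Fin r) → Fin t → ZMod 2) (i : Fin r),
      ∑ I : lowerHalf r with i ∈ I.1, s I.1 = ∑ I ∈ lowerHalf r with i ∈ I, s I := by
    intro s i
    rw [sum_filter, sum_filter, ← sum_coe_sort (lowerHalf r)]
  constructor
  · rintro ⟨x, s, rfl⟩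
    let s' : Finset (Fin r) → Fin t → ZMod 2 := fun I =>
      if h : I ∈ lowerHalf r then s.coord ⟨I, h⟩ else 0
    have hs' : ∀ I : lowerHalf r, s' I.1 = s.coord I := fun I => by simp [s']
    have heq : edgeTuple x s = halfTuple (lowerHalf r) x s' := by
      funext i
      simp only [edgeTuple, halfTuple, ← hsum, hs']
    refine ⟨_, ?_, rfl⟩
    rw [heq]
    refine isHalfSystem_lowerHalf.isEdgeTuple x (fun I hI => ?_) fun I hI J hJ h => ?_
    · rw [hs' ⟨I, hI⟩]
      exact s.coord_mem _
    · rw [hs' ⟨I, hI⟩, hs' ⟨J, hJ⟩] at h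
      exact congrArg Subtype.val (s.coord_injective h)
  · rintro ⟨v, hv, rfl⟩
    obtain ⟨x, s, hs, hinj, rfl⟩ := hv.exists_halfTuple isHalfSystem_lowerHalf
    refine ⟨x, ⟨fun I => s I.1, fun I => hs _ I.2, fun I J h => Subtype.ext (hinj I.2 J.2 h)⟩, ?_⟩
    congr 1
    funext i
    simp only [edgeTuple, halfTuple, ← hsum]

end HalfSystem

/-! ### Parametrizing edges by permutations, and codegrees -/

section Counting

open Finset
open scoped Classical

variable {r t : ℕ} {S : Finset (Fin t → ZMod 2)} {ι : Finset (Fin r) ↪ S}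

theorem halfTuple_add_halfTuple {V : Type*} [AddCommGroup V] [Module (ZMod 2) V]
    (A : Finset (Finset (Fin r))) (x : V) (s : Finset (Fin r) → V) (j k : Fin r) :
    halfTuple A x s j + halfTuple A x s k = ∑ I ∈ A with ¬(j ∈ I ↔ k ∈ I), s I := by
  rw [halfTuple, halfTuple, add_add_add_comm, ZModModule.add_self, zero_add, sum_filter, sum_filter,
    sum_filter, ← sum_add_distrib]
  refine sum_congr rfl fun I _ => ?_
  by_cases hj : j ∈ I <;> by_cases hk : k ∈ I <;> simp [hj, hk, ZModModule.add_self]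

/-- Each side sums at most `2 ^ r` distinct elements of `S`, so equal sums mean equal sets, and `π`
drops out. This is why the fibre sizes below do not depend on the edge. -/
theorem sum_perm_eq_iff (hS : DistinctSums (2 ^ r) S) (A : Finset (Finset (Fin r)))
    (π ρ : Equiv.Perm S) :
    ∑ I ∈ A, ((π * ρ) (ι I)).1 = ∑ I ∈ A, (π (ι I)).1 ↔
      A.image (fun I => ρ (ι I)) = A.image ι := by
  have hinj : Function.Injective fun a : S => (π a).1 :=
    Subtype.val_injective.comp π.injective
  have hsum : ∀ σ : Finset (Fin r) → S, Function.Injective σ →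
      ∑ I ∈ A, (π (σ I)).1 = ∑ a ∈ (A.image σ).image fun a : S => (π a).1, a := by
    intro σ hσ
    rw [sum_image hinj.injOn, sum_image hσ.injOn]
  have h1 := hsum (fun I => ρ (ι I)) (ρ.injective.comp ι.injective)
  have h2 := hsum ι ι.injective
  simp only [Equiv.Perm.mul_apply]
  rw [h1, h2]
  have hcard : ∀ σ : Finset (Fin r) → S,
      #((A.image σ).image fun a : S => (π a).1) ≤ 2 ^ r := by
    intro σ
    refine card_image_le.trans (card_image_le.trans ((card_le_univ A).trans ?_))
    simp
  have hsub : ∀ B : Finset S, B.image (fun a : S => (π a).1) ⊆ S := by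
    intro B a ha
    obtain ⟨b, -, rfl⟩ := mem_image.1 ha
    exact (π b).2
  constructor
  · intro h
    exact image_injective hinj (hS _ (hsub _) _ (hsub _) (hcard _) (hcard _) h)
  · intro h
    rw [h]

theorem exists_eq_insert_of_subset (hr : 3 ≤ r) (hS : DistinctSums (2 ^ r) S)
    (g : KEdge (booleanHypergraph r t S) (r - 1)) {e : Set (Fin t → ZMod 2)}
    (he : e ∈ (booleanHypergraph r t S).edgeSet) (hg : g.1 ⊆ e) :
    ∃ w, w ∉ g.1 ∧ e = insert w g.1 := by
  have hcard := (booleanHypergraph_isUniform hr hS e he).1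
  obtain ⟨w, hw, hwg⟩ := Set.exists_mem_notMem_of_ncard_lt_ncard
    (show g.1.ncard < e.ncard by rw [g.2.1, hcard]; omega)
  refine ⟨w, hwg, (Set.eq_of_subset_of_ncard_le (Set.insert_subset hw hg) ?_ (Set.toFinite _)).symm⟩
  rw [Set.ncard_insert_of_notMem hwg (Set.toFinite _), g.2.1, hcard]
  omega

variable [NeZero r]

/-- The edge tuple with base vertex `x` and labels `π (ι I)`. -/
def permTuple (ι : Finset (Fin r) ↪ S) (x : Fin t → ZMod 2) (π : Equiv.Perm S) :
    Fin r → Fin t → ZMod 2 :=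
  halfTuple (avoidZero r) x fun I => (π (ι I)).1

theorem permTuple_zero (x : Fin t → ZMod 2) (π : Equiv.Perm S) : permTuple ι x π 0 = x := by
  rw [permTuple, halfTuple, filter_eq_empty_iff.2, sum_empty, add_zero]
  exact fun I hI => (mem_avoidZero.1 hI).2

theorem isEdgeTuple_permTuple (x : Fin t → ZMod 2) (π : Equiv.Perm S) :
    IsEdgeTuple S (permTuple ι x π) :=
  isHalfSystem_avoidZero.isEdgeTuple x (fun _ _ => (π _).2) fun _ _ _ _ h =>
    ι.injective (π.injective (Subtype.ext h))

theorem IsEdgeTuple.exists_permTuple {v : Fin r → Fin t → ZMod 2} (hv : IsEdgeTuple S v)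
    (ι : Finset (Fin r) ↪ S) : ∃ x π, permTuple ι x π = v := by
  obtain ⟨x, s, hs, hinj, rfl⟩ := hv.exists_halfTuple isHalfSystem_avoidZero
  obtain ⟨π, hπ⟩ := Equiv.Perm.exists_extending_pair
    (fun I : avoidZero r => ι I.1) (fun I : avoidZero r => (⟨s I.1, hs _ I.2⟩ : S))
    (fun I J h => Subtype.ext (ι.injective h))
    (fun I J h => Subtype.ext (hinj I.2 J.2 (congrArg Subtype.val h)))
  refine ⟨x, π, ?_⟩
  funext i
  refine congrArg (x + ·) (sum_congr rfl fun I hI => ?_)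
  exact congrArg Subtype.val (hπ ⟨I, (mem_filter.1 hI).1⟩)

/-- The permutations of `S` that do not change any label. -/
noncomputable def labelStabilizer (ι : Finset (Fin r) ↪ S) : Finset (Equiv.Perm S) :=
  univ.filter fun ρ => ∀ I ∈ avoidZero r, ρ (ι I) = ι I

/-- The permutations of `S` that do not change the differences of the vertices other than the
first one. -/
noncomputable def tailStabilizer (ι : Finset (Fin r) ↪ S) : Finset (Equiv.Perm S) :=
  univ.filter fun ρ => ∀ j k : Fin r, j ≠ 0 → k ≠ 0 →
    ((avoidZero r).filter fun I => ¬(j ∈ I ↔ k ∈ I)).image (fun I => ρ (ι I)) =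
      ((avoidZero r).filter fun I => ¬(j ∈ I ↔ k ∈ I)).image ι

theorem card_labelStabilizer_pos : 0 < #(labelStabilizer ι) :=
  card_pos.2 ⟨1, by simp [labelStabilizer]⟩

theorem permTuple_mul_of_mem_labelStabilizer {ρ : Equiv.Perm S} (hρ : ρ ∈ labelStabilizer ι)
    (x : Fin t → ZMod 2) (π : Equiv.Perm S) : permTuple ι x (π * ρ) = permTuple ι x π := by
  funext i
  refine congrArg (x + ·) (sum_congr rfl fun I hI => ?_)
  dsimp only
  rw [Equiv.Perm.mul_apply, (mem_filter.1 hρ).2 I (mem_filter.1 hI).1]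

theorem permTuple_eq_iff (hS : DistinctSums (2 ^ r) S) {x y : Fin t → ZMod 2}
    {π ρ : Equiv.Perm S} :
    permTuple ι y (π * ρ) = permTuple ι x π ↔ y = x ∧ ρ ∈ labelStabilizer ι := by
  constructor
  · intro h
    have hx : y = x := by rw [← permTuple_zero (ι := ι) y (π * ρ), h, permTuple_zero]
    subst hx
    refine ⟨rfl, mem_filter.2 ⟨mem_univ _, fun I hI => ?_⟩⟩
    -- Equality at vertex `j` says that `ρ` preserves the set of labels occurring there. So `ρ (ι I)
    -- = ι J` with `J` containing the same indices as `I`.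
    have himg : ∀ j, ((avoidZero r).filter (j ∈ ·)).image (fun I => ρ (ι I)) =
        ((avoidZero r).filter (j ∈ ·)).image ι := fun j =>
      (sum_perm_eq_iff hS _ π ρ).1 (add_left_cancel (congrFun h j))
    have hmem : ∀ j, j ∈ I → ∃ J ∈ avoidZero r, j ∈ J ∧ ι J = ρ (ι I) := by
      intro j hj
      have h1 : ρ (ι I) ∈ ((avoidZero r).filter (j ∈ ·)).image fun I => ρ (ι I) :=
        mem_image_of_mem _ (mem_filter.2 ⟨hI, hj⟩)
      rw [himg] at h1
      obtain ⟨J, hJ, hJ'⟩ := mem_image.1 h1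
      exact ⟨J, (mem_filter.1 hJ).1, (mem_filter.1 hJ).2, hJ'⟩
    obtain ⟨j, hj⟩ := (mem_avoidZero.1 hI).1
    obtain ⟨J, hJ, -, hJI⟩ := hmem j hj
    rw [← hJI]
    congr 1
    refine subset_antisymm (fun k hk => ?_) fun k hk => ?_
    · have h1 : ρ (ι I) ∈ ((avoidZero r).filter (k ∈ ·)).image fun I => ρ (ι I) := by
        rw [himg, ← hJI]
        exact mem_image_of_mem _ (mem_filter.2 ⟨hJ, hk⟩)
      obtain ⟨L, hL, hL'⟩ := mem_image.1 h1
      exact ι.injective (ρ.injective hL') ▸ (mem_filter.1 hL).2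
    · obtain ⟨L, -, hkL, hL⟩ := hmem k hk
      exact ι.injective (hL.trans hJI.symm) ▸ hkL
  · rintro ⟨rfl, h⟩
    exact permTuple_mul_of_mem_labelStabilizer h _ _

theorem card_permTuple_eq (hS : DistinctSums (2 ^ r) S) {v : Fin r → Fin t → ZMod 2}
    (hv : IsEdgeTuple S v) :
    #{p : (Fin t → ZMod 2) × Equiv.Perm S | permTuple ι p.1 p.2 = v} = #(labelStabilizer ι) := by
  obtain ⟨x, π, rfl⟩ := hv.exists_permTuple ι
  symm
  refine card_bij (fun ρ _ => (x, π * ρ)) (fun ρ hρ => ?_) (fun ρ _ ρ' _ h => ?_) fun p hp => ?_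
  · simpa using (permTuple_eq_iff hS).2 ⟨rfl, hρ⟩
  · simpa using h
  · obtain ⟨y, σ⟩ := p
    have h : permTuple ι y (π * (π⁻¹ * σ)) = permTuple ι x π := by simpa using hp
    obtain ⟨rfl, h'⟩ := (permTuple_eq_iff hS).1 h
    exact ⟨π⁻¹ * σ, h', by simp⟩

/-- Only the differences among vertices other than `0` constrain `ρ`; once they agree, exactly one
base point makes a chosen vertex `i ≠ 0`, hence the whole tail, agree. -/
theorem card_permTuple_tail_eq (hr : 2 ≤ r) (hS : DistinctSums (2 ^ r) S)
    {v : Fin r → Fin t → ZMod 2} (hv : IsEdgeTuple S v) :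
    #{p : (Fin t → ZMod 2) × Equiv.Perm S | ∀ j, j ≠ 0 → permTuple ι p.1 p.2 j = v j} =
      #(tailStabilizer ι) := by
  obtain ⟨x, π, rfl⟩ := hv.exists_permTuple ι
  symm
  obtain ⟨i, hi⟩ : ∃ i : Fin r, i ≠ 0 := ⟨⟨1, hr⟩, fun h => by
    have := congrArg Fin.val h
    simp at this⟩
  let base : Equiv.Perm S → Fin t → ZMod 2 := fun ρ =>
    permTuple ι x π i + ∑ I ∈ avoidZero r with i ∈ I, ((π * ρ) (ι I)).1
  have hbase : ∀ ρ, permTuple ι (base ρ) (π * ρ) i = permTuple ι x π i := by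
    intro ρ
    rw [permTuple, halfTuple, add_assoc, ZModModule.add_self, add_zero]
  have hdiff : ∀ ρ y, (∀ j, j ≠ 0 → permTuple ι y (π * ρ) j = permTuple ι x π j) →
      ρ ∈ tailStabilizer ι := by
    intro ρ y h
    refine mem_filter.2 ⟨mem_univ _, fun j k hj hk => (sum_perm_eq_iff hS _ π ρ).1 ?_⟩
    rw [← halfTuple_add_halfTuple _ y (fun I => ((π * ρ) (ι I)).1),
      ← halfTuple_add_halfTuple _ x (fun I => (π (ι I)).1)]
    exact congrArg₂ (· + ·) (h j hj) (h k hk)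
  refine card_bij (fun ρ _ => (base ρ, π * ρ)) (fun ρ hρ => ?_) (fun ρ _ ρ' _ h => ?_)
    fun p hp => ?_
  · refine mem_filter.2 ⟨mem_univ _, fun j hj => ?_⟩
    have h1 := (sum_perm_eq_iff hS _ π ρ).2 ((mem_filter.1 hρ).2 i j hi hj)
    rw [← halfTuple_add_halfTuple _ (base ρ) (fun I => ((π * ρ) (ι I)).1),
      ← halfTuple_add_halfTuple _ x (fun I => (π (ι I)).1)] at h1
    have h2 := hbase ρ
    rw [permTuple, permTuple] at h2
    rw [h2] at h1
    exact add_left_cancel h1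
  · exact mul_left_cancel (congrArg Prod.snd h)
  · obtain ⟨y, σ⟩ := p
    have h : ∀ j, j ≠ 0 → permTuple ι y (π * (π⁻¹ * σ)) j = permTuple ι x π j := by
      simpa using hp
    refine ⟨π⁻¹ * σ, hdiff _ y h, Prod.ext ?_ (by simp)⟩
    have h1 := h i hi
    rw [← hbase (π⁻¹ * σ), permTuple, permTuple, halfTuple, halfTuple] at h1
    exact (add_right_cancel h1).symm

/-! ### From ordered tuples to edges and faces -/

theorem IsEdgeTuple.range_mem_edgeSet {v : Fin r → Fin t → ZMod 2} (hv : IsEdgeTuple S v) :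
    Set.range v ∈ (booleanHypergraph r t S).edgeSet :=
  mem_edgeSet_booleanHypergraph.2 ⟨v, hv, rfl⟩

theorem IsEdgeTuple.injective (hr : 3 ≤ r) (hS : DistinctSums (2 ^ r) S)
    {v : Fin r → Fin t → ZMod 2} (hv : IsEdgeTuple S v) : Function.Injective v := by
  have h := (booleanHypergraph_isUniform hr hS _ hv.range_mem_edgeSet).1
  rw [← Set.image_univ] at h
  refine Set.injOn_univ.1 (Set.injOn_of_ncard_image_eq ?_ Set.finite_univ)
  rw [h]
  simp

theorem IsEdgeTuple.of_range_eq (hr : 3 ≤ r) (hS : DistinctSums (2 ^ r) S)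
    {u v : Fin r → Fin t → ZMod 2} (hv : IsEdgeTuple S v) (hu : Function.Injective u)
    (h : Set.range u = Set.range v) : IsEdgeTuple S u := by
  have hvi := hv.injective hr hS
  convert hv.comp_perm ((Equiv.ofInjective u hu).trans
    ((Equiv.setCongr h).trans (Equiv.ofInjective v hvi).symm)) using 1
  funext i
  simp [Equiv.apply_ofInjective_symm]

theorem range_update_zero (u : Fin r → Fin t → ZMod 2) (w : Fin t → ZMod 2) :
    Set.range (Function.update u 0 w) = insert w (u '' {0}ᶜ) := by
  ext y
  simp only [Set.mem_range, Set.mem_insert_iff, Set.mem_image, Set.mem_compl_iff,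
    Set.mem_singleton_iff]
  constructor
  · rintro ⟨i, rfl⟩
    by_cases hi : i = 0
    · subst hi
      simp
    · exact Or.inr ⟨i, hi, by simp [hi]⟩
  · rintro (rfl | ⟨i, hi, rfl⟩)
    · exact ⟨0, by simp⟩
    · exact ⟨i, by simp [hi]⟩

/-- Every `(r - 1)`-edge is obtained from an edge tuple by dropping the first entry. -/
theorem exists_tail_eq (hr : 3 ≤ r) (hS : DistinctSums (2 ^ r) S)
    (g : KEdge (booleanHypergraph r t S) (r - 1)) :
    ∃ u : Fin r → Fin t → ZMod 2, IsEdgeTuple S u ∧ u '' {0}ᶜ = g.1 := by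
  obtain ⟨e, he, hge⟩ := g.2.2.2
  obtain ⟨w, hw, rfl⟩ := exists_eq_insert_of_subset hr hS g he hge
  obtain ⟨v, hv, hve⟩ := mem_edgeSet_booleanHypergraph.1 he
  obtain ⟨i, rfl⟩ : w ∈ Set.range v := hve ▸ Set.mem_insert _ _
  have hinj := (hv.comp_perm (Equiv.swap 0 i)).injective hr hS
  refine ⟨v ∘ Equiv.swap 0 i, hv.comp_perm _, ?_⟩
  rw [Set.compl_eq_univ_sdiff, Set.image_sdiff hinj, Set.image_univ, EquivLike.range_comp, ← hve]
  simp [hw]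

/-- With the tail prescribed, the coface `e` leaves one possible vertex for position `0`, so a
single tuple is counted. -/
theorem card_tail_range_eq (hr : 3 ≤ r) (hS : DistinctSums (2 ^ r) S)
    (g : KEdge (booleanHypergraph r t S) (r - 1)) {u : Fin r → Fin t → ZMod 2}
    (hu : IsEdgeTuple S u) (hug : u '' {0}ᶜ = g.1) {e : Set (Fin t → ZMod 2)}
    (he : e ∈ cofaces g) :
    #{p ∈ {p : (Fin t → ZMod 2) × Equiv.Perm S | ∀ j, j ≠ 0 → permTuple ι p.1 p.2 j = u j} |
      Set.range (permTuple ι p.1 p.2) = e} = #(labelStabilizer ι) := by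
  obtain ⟨he, hge⟩ := mem_filter.1 he
  rw [mem_edges] at he
  obtain ⟨w, hw, rfl⟩ := exists_eq_insert_of_subset hr hS g he hge
  obtain ⟨v, hv, hve⟩ := mem_edgeSet_booleanHypergraph.1 he
  have hrange : Set.range (Function.update u 0 w) = insert w g.1 := by
    rw [range_update_zero, hug]
  have hinj : Function.Injective (Function.update u 0 w) := by
    have hui := hu.injective hr hS
    have hwu : ∀ j, j ≠ 0 → u j ≠ w := fun j hj h => hw (hug ▸ ⟨j, hj, h⟩)
    intro i j hij
    by_cases hi : i = 0 <;> by_cases hj : j = 0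
    · rw [hi, hj]
    · subst hi
      simp only [Function.update_self, Function.update_of_ne hj] at hij
      exact absurd hij.symm (hwu j hj)
    · subst hj
      simp only [Function.update_self, Function.update_of_ne hi] at hij
      exact absurd hij (hwu i hi)
    · simp only [Function.update_of_ne hi, Function.update_of_ne hj] at hij
      exact hui hij
  have hup : IsEdgeTuple S (Function.update u 0 w) :=
    hv.of_range_eq hr hS hinj (hrange.trans hve)
  rw [← card_permTuple_eq (ι := ι) hS hup, filter_filter]
  congr 1
  refine filter_congr fun p _ => ?_
  constructor
  · rintro ⟨h1, h2⟩
    funext j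
    by_cases hj : j = 0
    · subst hj
      rw [Function.update_self]
      have h3 : permTuple ι p.1 p.2 0 ∈ insert w g.1 := h2 ▸ Set.mem_range_self _
      refine h3.resolve_right fun h4 => ?_
      rw [← hug] at h4
      obtain ⟨j, hj, hj'⟩ := h4
      rw [← h1 j hj] at hj'
      exact hj ((isEdgeTuple_permTuple p.1 p.2).injective hr hS hj')
    · rw [h1 j hj, Function.update_of_ne hj]
  · intro h
    refine ⟨fun j hj => by rw [h, Function.update_of_ne hj], by rw [h, hrange]⟩

/-- Sort the parameters with a fixed tail by the edge they produce; every coface of `g` has a fibre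
of the same size. -/
theorem card_labelStabilizer_mul_card_cofaces (hr : 3 ≤ r) (hS : DistinctSums (2 ^ r) S)
    (g : KEdge (booleanHypergraph r t S) (r - 1)) :
    #(cofaces g) * #(labelStabilizer ι) = #(tailStabilizer ι) := by
  obtain ⟨u, hu, hug⟩ := exists_tail_eq hr hS g
  rw [← card_permTuple_tail_eq (by omega) hS hu,
    card_eq_sum_card_fiberwise (t := cofaces g)
      (f := fun p : (Fin t → ZMod 2) × Equiv.Perm S => Set.range (permTuple ι p.1 p.2)),
    sum_congr rfl fun e he => card_tail_range_eq hr hS g hu hug he, sum_const, smul_eq_mul]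
  intro p hp
  have hp' : ∀ j, j ≠ 0 → permTuple ι p.1 p.2 j = u j := by simpa using hp
  refine mem_filter.2 ⟨mem_edges.2 (isEdgeTuple_permTuple _ _).range_mem_edgeSet, ?_⟩
  rw [← hug]
  rintro _ ⟨j, hj, rfl⟩
  exact ⟨j, hp' j hj⟩

/-- Only one ordering of `g` is counted, hence an inequality, which suffices for the norm
comparison. -/
theorem le_card_tail_eq (hr : 3 ≤ r) (hS : DistinctSums (2 ^ r) S)
    (g : KEdge (booleanHypergraph r t S) (r - 1)) :
    #(cofaces g) * #(labelStabilizer ι) ≤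
      #{p : (Fin t → ZMod 2) × Equiv.Perm S | permTuple ι p.1 p.2 '' {0}ᶜ = g.1} := by
  obtain ⟨u, hu, hug⟩ := exists_tail_eq hr hS g
  rw [card_labelStabilizer_mul_card_cofaces hr hS, ← card_permTuple_tail_eq (by omega) hS hu]
  refine card_le_card fun p hp => ?_
  have hp' : ∀ j, j ≠ 0 → permTuple ι p.1 p.2 j = u j := by simpa using hp
  refine mem_filter.2 ⟨mem_univ _, ?_⟩
  rw [← hug]
  exact Set.image_congr fun j hj => hp' j hj

theorem card_range_eq_le (hr : 3 ≤ r) (hS : DistinctSums (2 ^ r) S) {e : Set (Fin t → ZMod 2)}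
    (he : e ∈ (booleanHypergraph r t S).edgeSet) :
    #{p : (Fin t → ZMod 2) × Equiv.Perm S | Set.range (permTuple ι p.1 p.2) = e} ≤
      #(labelStabilizer ι) * r ^ r := by
  have hcard : #(Fintype.piFinset fun _ : Fin r => e.toFinset) = r ^ r := by
    rw [Fintype.card_piFinset_const, ← Set.ncard_eq_toFinset_card',
      (booleanHypergraph_isUniform hr hS e he).1]
  rw [← hcard]
  refine card_le_mul_card_image_of_maps_to
    (f := fun p : (Fin t → ZMod 2) × Equiv.Perm S => permTuple ι p.1 p.2)
    (fun p hp => ?_) _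
    fun v hv => ?_
  · have hp' : Set.range (permTuple ι p.1 p.2) = e := by simpa using hp
    simp [Fintype.mem_piFinset, ← hp']
  · by_cases h : IsEdgeTuple S v
    · rw [← card_permTuple_eq hS h]
      exact card_le_card (filter_subset_filter _ (filter_subset _ _))
    · rw [filter_eq_empty_iff.2, card_empty]
      · exact Nat.zero_le _
      · rintro p - rfl
        exact h (isEdgeTuple_permTuple _ _)

end Counting

/-! ### Poincaré inequalities on products with symmetric groups -/

section Poincare

open Finset
open scoped Classical

/-! ### L² norms on finite types -/

section EuclideanLength

variable {Ω : Type*} [Fintype Ω]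

/-- The Euclidean norm of a function on a finite type. -/
noncomputable def l2norm (F : Ω → ℝ) : ℝ := √(∑ p, F p ^ 2)

theorem l2norm_nonneg (F : Ω → ℝ) : 0 ≤ l2norm F := Real.sqrt_nonneg _

theorem sq_l2norm (F : Ω → ℝ) : l2norm F ^ 2 = ∑ p, F p ^ 2 :=
  Real.sq_sqrt (sum_nonneg fun _ _ => sq_nonneg _)

theorem l2norm_add_le (F G : Ω → ℝ) : l2norm (F + G) ≤ l2norm F + l2norm G := by
  have h := norm_add_le (WithLp.toLp 2 F : EuclideanSpace ℝ Ω) (WithLp.toLp 2 G)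
  simpa [EuclideanSpace.norm_eq, l2norm] using h

theorem l2norm_neg (F : Ω → ℝ) : l2norm (-F) = l2norm F := by simp [l2norm]

theorem l2norm_comp (F : Ω → ℝ) (e : Ω ≃ Ω) : l2norm (F ∘ e) = l2norm F := by
  rw [l2norm, l2norm, ← Equiv.sum_comp e fun p => F p ^ 2]
  rfl

end EuclideanLength

/-! ### Subadditive length functions on symmetric groups -/

section SymmetricGroup

variable {α : Type*} [DecidableEq α] {L : Equiv.Perm α → ℝ}

theorem length_swap_le (hmul : ∀ σ τ, L (σ * τ) ≤ L σ + L τ) {B : ℝ} {z : α}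
    (hz : ∀ u, L (Equiv.swap z u) ≤ B) (hB : 0 ≤ B) (u w : α) : L (Equiv.swap u w) ≤ 3 * B := by
  rcases eq_or_ne u w with rfl | huw
  · have := hz z
    rw [Equiv.swap_self] at this ⊢
    linarith
  · rcases eq_or_ne z w with rfl | hzw
    · rw [Equiv.swap_comm]
      linarith [hz u]
    · rw [← Equiv.swap_mul_swap_mul_swap hzw.symm huw.symm, Equiv.swap_comm w z]
      have h1 := hmul (Equiv.swap z u * Equiv.swap z w) (Equiv.swap z u)
      have h2 := hmul (Equiv.swap z u) (Equiv.swap z w)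
      linarith [hz u, hz w]

/-- If a length function on a symmetric group is at most `M` on transpositions and vanishes on the
permutations fixing `A` pointwise, then it is at most `|A| M`. -/
theorem length_le_card_mul (hmul : ∀ σ τ, L (σ * τ) ≤ L σ + L τ) {M : ℝ}
    (hM : ∀ u w, L (Equiv.swap u w) ≤ M) (A : Finset α) (hA : ∀ ρ, (∀ a ∈ A, ρ a = a) → L ρ ≤ 0)
    (ρ : Equiv.Perm α) : L ρ ≤ #A * M := by
  have key : ∀ B : Finset α, ∃ ρ' : Equiv.Perm α, (∀ a ∈ B, ρ' a = a) ∧ L ρ ≤ L ρ' + #B * M := by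
    intro B
    induction B using Finset.induction_on with
    | empty => exact ⟨ρ, by simp, by simp⟩
    | insert a B ha ih =>
      obtain ⟨ρ', hfix, hle⟩ := ih
      -- This transposition brings `a` back without disturbing `B`, at a cost of at most `M`.
      refine ⟨Equiv.swap a (ρ' a) * ρ', fun b hb => ?_, ?_⟩
      · rw [Equiv.Perm.mul_apply]
        rcases mem_insert.1 hb with rfl | hb
        · exact Equiv.swap_apply_right _ _
        · rw [hfix b hb]
          refine Equiv.swap_apply_of_ne_of_ne (fun h => ha (h ▸ hb)) fun h => ?_
          rw [← hfix b hb] at h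
          exact ha (ρ'.injective h ▸ hb)
      · have h1 := hmul (Equiv.swap a (ρ' a)) (Equiv.swap a (ρ' a) * ρ')
        rw [← mul_assoc, Equiv.swap_mul_self, one_mul] at h1
        rw [card_insert_of_notMem ha]
        push_cast
        linarith [hM a (ρ' a)]
  obtain ⟨ρ', hfix, hle⟩ := key A
  linarith [hA ρ' hfix]

/-- A length function on the permutations of a set labelled by sets of indices is controlled by
its values at the transpositions of neighbours in the hypercube. -/
theorem length_le_of_hypercube {r : ℕ} [NeZero r] {ι : Finset (Fin r) ↪ α}
    (hmul : ∀ σ τ, L (σ * τ) ≤ L σ + L τ) {B : ℝ} (hB : 0 ≤ B)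
    (hfix : ∀ ρ, (∀ I ∈ avoidZero r, ρ (ι I) = ι I) → L ρ ≤ 0)
    (hedge : ∀ (I : Finset (Fin r)) (i : Fin r), 0 ∉ I → i ≠ 0 → i ∉ I →
      L (Equiv.swap (ι I) (ι (insert i I))) ≤ B) (ρ : Equiv.Perm α) :
    L ρ ≤ 6 * r * 2 ^ r * B := by
  -- Go from `∅` to `I` adding one point at a time; each later step conjugates by one hypercube
  -- transposition and costs `2 * B`.
  have hstar : ∀ I : Finset (Fin r), 0 ∉ I → L (Equiv.swap (ι ∅) (ι I)) ≤ 2 * #I * B := by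
    intro I
    induction I using Finset.induction_on with
    | empty =>
      intro _
      rw [Equiv.swap_self]
      simpa using hfix (Equiv.refl α) fun _ _ => rfl
    | insert i I hi ih =>
      intro h0
      have h0' : 0 ≠ i ∧ 0 ∉ I := by simpa using h0
      have h1 := hedge I i h0'.2 h0'.1.symm hi
      rcases I.eq_empty_or_nonempty with rfl | hI
      · rw [card_insert_of_notMem hi, card_empty]
        push_cast
        linarith
      have hne : ι ∅ ≠ ι (insert i I) := fun h => insert_ne_empty _ _ (ι.injective h).symm
      have hne' : ι ∅ ≠ ι I := fun h => hI.ne_empty (ι.injective h).symm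
      have h2 : Equiv.swap (ι I) (ι (insert i I)) * Equiv.swap (ι ∅) (ι I) *
          Equiv.swap (ι I) (ι (insert i I)) = Equiv.swap (ι ∅) (ι (insert i I)) := by
        rw [Equiv.swap_mul_swap_mul_swap hne' hne, Equiv.swap_comm]
      rw [← h2, card_insert_of_notMem hi]
      push_cast
      have h3 := hmul (Equiv.swap (ι I) (ι (insert i I)) * Equiv.swap (ι ∅) (ι I))
        (Equiv.swap (ι I) (ι (insert i I)))
      have h4 := hmul (Equiv.swap (ι I) (ι (insert i I))) (Equiv.swap (ι ∅) (ι I))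
      linarith [ih h0'.2]
  have hz : ∀ u, L (Equiv.swap (ι ∅) u) ≤ 2 * r * B := by
    intro u
    have hpos : 0 ≤ 2 * r * B := by positivity
    by_cases hu : ∃ I ∈ avoidZero r, ι I = u
    · obtain ⟨I, hI, rfl⟩ := hu
      refine (hstar I (mem_avoidZero.1 hI).2).trans ?_
      have : (#I : ℝ) ≤ r := by exact_mod_cast (card_le_univ I).trans_eq (Fintype.card_fin r)
      gcongr
    · refine (hfix _ fun I hI => ?_).trans hpos
      refine Equiv.swap_apply_of_ne_of_ne (fun h => ?_) fun h => hu ⟨I, hI, h⟩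
      exact (mem_avoidZero.1 hI).1.ne_empty (ι.injective h)
  have hswap := length_swap_le hmul hz (by positivity)
  refine (length_le_card_mul hmul hswap ((avoidZero r).map ι) (fun ρ hρ => hfix ρ fun I hI =>
    hρ _ (mem_map_of_mem ι hI)) ρ).trans ?_
  have hcard : (#((avoidZero r).map ι) : ℝ) ≤ 2 ^ r := by
    rw [card_map]
    exact_mod_cast (card_le_univ _).trans_eq (by simp)
  calc _ ≤ (2 : ℝ) ^ r * (3 * (2 * r * B)) := by gcongr
    _ = _ := by ring

end SymmetricGroup

/-! ### Averaging over permutations and the Cayley walk -/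

section Product

/-- Translating the first component by the sum of two labels. -/
def labelShift {V : Type*} [AddCommGroup V] [Module (ZMod 2) V] {S : Finset V} (a b : S) :
    V × Equiv.Perm S ≃ V × Equiv.Perm S :=
  Function.Involutive.toPerm (fun p => (p.1 + (p.2 a + p.2 b : V), p.2)) fun p => by
    simp [add_assoc, ZModModule.add_self]

theorem labelShift_apply {V : Type*} [AddCommGroup V] [Module (ZMod 2) V] {S : Finset V} (a b : S)
    (p : V × Equiv.Perm S) :
    labelShift a b p = (p.1 + (p.2 a + p.2 b : V), p.2) := rfl

variable {V : Type*} [Fintype V] [DecidableEq V] {S : Finset V}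

/-- The distance in Euclidean norm between a function on `V × Perm S` and its translate by a
permutation. -/
noncomputable def permLength (F : V × Equiv.Perm S → ℝ) (ρ : Equiv.Perm S) : ℝ :=
  l2norm fun p => F (p.1, p.2 * ρ) - F p

theorem l2norm_comp_mul (F : V × Equiv.Perm S → ℝ) (ρ : Equiv.Perm S) :
    l2norm (fun p : V × Equiv.Perm S => F (p.1, p.2 * ρ)) = l2norm F :=
  l2norm_comp F ((Equiv.refl V).prodCongr (Equiv.mulRight ρ))

theorem permLength_mul_le (F : V × Equiv.Perm S → ℝ) (σ τ : Equiv.Perm S) :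
    permLength F (σ * τ) ≤ permLength F σ + permLength F τ := by
  have h := l2norm_add_le (fun p => F (p.1, p.2 * σ * τ) - F (p.1, p.2 * σ))
    (fun p => F (p.1, p.2 * σ) - F p)
  have h1 := l2norm_comp_mul (fun p => F (p.1, p.2 * τ) - F p) σ
  rw [h1] at h
  rw [add_comm, permLength]
  refine le_trans (le_of_eq ?_) h
  congr 1
  funext p
  simp [mul_assoc]

/-- Replace `F` by the invariant `F'` at both ends of the difference. -/
theorem permLength_le_of_invariant (F F' : V × Equiv.Perm S → ℝ) {ρ : Equiv.Perm S}
    (h : ∀ p, F' (p.1, p.2 * ρ) = F' p) : permLength F ρ ≤ 2 * l2norm (F' - F) := by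
  have h1 := l2norm_add_le (-fun p => (F' - F) (p.1, p.2 * ρ)) (F' - F)
  rw [l2norm_neg, l2norm_comp_mul, ← two_mul] at h1
  refine le_trans (le_of_eq ?_) h1
  rw [permLength]
  congr 1
  funext p
  simp [h]

/-- The average over the permutations. -/
noncomputable def permMean (F : V × Equiv.Perm S → ℝ) (x : V) : ℝ :=
  (∑ π : Equiv.Perm S, F (x, π)) / Fintype.card (Equiv.Perm S)

variable {F : V × Equiv.Perm S → ℝ} {M : ℝ}

/-- The deviation from the mean is an average of differences under permutations, so Cauchy–Schwarz
applies. -/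
theorem l2norm_sub_permMean_le (hM0 : 0 ≤ M) (hM : ∀ ρ, permLength F ρ ≤ M) :
    l2norm (fun p => F p - permMean F p.1) ≤ M := by
  set n : ℝ := ((Fintype.card (Equiv.Perm S) : ℕ) : ℝ) with hn
  have hn0 : 0 < n := by
    rw [hn]
    exact_mod_cast Fintype.card_pos
  have hpt : ∀ p : V × Equiv.Perm S, n * (F p - permMean F p.1) ^ 2 ≤
      ∑ ρ : Equiv.Perm S, (F (p.1, p.2 * ρ) - F p) ^ 2 := by
    rintro ⟨x, π⟩
    have h1 : -(n * (F (x, π) - permMean F x)) = ∑ ρ : Equiv.Perm S, (F (x, π * ρ) - F (x, π)) := by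
      have h0 : ∑ ρ : Equiv.Perm S, F (x, π * ρ) = ∑ ρ : Equiv.Perm S, F (x, ρ) :=
        Equiv.sum_comp (Equiv.mulLeft π) fun ρ => F (x, ρ)
      rw [sum_sub_distrib, sum_const, nsmul_eq_mul, card_univ, h0, permMean, ← hn]
      field_simp
      ring
    have h2 := sq_sum_le_card_mul_sum_sq (s := univ)
      (f := fun ρ : Equiv.Perm S => F (x, π * ρ) - F (x, π))
    rw [← h1, card_univ, ← hn] at h2
    refine le_of_mul_le_mul_left ?_ hn0
    calc n * (n * (F (x, π) - permMean F x) ^ 2) = (-(n * (F (x, π) - permMean F x))) ^ 2 := by ring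
      _ ≤ _ := h2
  refine le_of_sq_le_sq ?_ hM0
  rw [sq_l2norm]
  refine le_of_mul_le_mul_left ?_ hn0
  rw [mul_sum]
  calc _ ≤ ∑ p : V × Equiv.Perm S, ∑ ρ : Equiv.Perm S, (F (p.1, p.2 * ρ) - F p) ^ 2 :=
        sum_le_sum fun p _ => hpt p
    _ = ∑ ρ : Equiv.Perm S, permLength F ρ ^ 2 := by
        rw [sum_comm]
        exact sum_congr rfl fun ρ _ => (sq_l2norm _).symm
    _ ≤ ∑ ρ : Equiv.Perm S, M ^ 2 :=
        sum_le_sum fun ρ _ => pow_le_pow_left₀ (l2norm_nonneg _) (hM ρ) 2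
    _ = n * M ^ 2 := by rw [sum_const, nsmul_eq_mul, card_univ, hn]

variable [AddCommGroup V] [Module (ZMod 2) V]

/-- Shift and exchange together fix `F`, so the shift alone changes it by at most `M`; passing to
the mean before and after the shift costs `M` each. -/
theorem l2norm_permMean_shift_le (hM0 : 0 ≤ M) (hM : ∀ ρ, permLength F ρ ≤ M) (a b : S)
    (hab : ∀ p : V × Equiv.Perm S, F (p.1 + (p.2 a + p.2 b : V), p.2 * Equiv.swap a b) = F p) :
    l2norm (fun p : V × Equiv.Perm S =>
      permMean F (p.1 + (p.2 a + p.2 b : V)) - permMean F p.1) ≤ 3 * M := by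
  have h0 := l2norm_sub_permMean_le hM0 hM
  have h1 := l2norm_comp (fun p => F p - permMean F p.1) (labelShift a b)
  have h2 : l2norm (fun p => F (labelShift a b p) - F p) ≤ M := by
    have h3 := l2norm_comp (fun p => F (p.1, p.2 * Equiv.swap a b) - F p) (labelShift a b)
    rw [← l2norm_neg]
    refine le_trans (le_of_eq ?_) (hM (Equiv.swap a b))
    rw [permLength, ← h3]
    congr 1
    funext p
    simp [labelShift_apply, hab]
  have h3 := l2norm_add_le (-((fun p => F p - permMean F p.1) ∘ labelShift a b))
    ((fun p => F (labelShift a b p) - F p) + fun p => F p - permMean F p.1)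
  have h4 := l2norm_add_le (fun p => F (labelShift a b p) - F p) fun p => F p - permMean F p.1
  rw [l2norm_neg, h1] at h3
  refine le_trans (le_of_eq ?_) (h3.trans (by linarith : _ ≤ 3 * M))
  congr 1
  funext p
  simp [labelShift_apply]

/-- The mean forgets `π`, so relabelling carries the bound from `(a, b)` to every pair of distinct
labels; equal labels give the zero shift. -/
theorem sum_sq_permMean_shift_le (hM0 : 0 ≤ M) (hM : ∀ ρ, permLength F ρ ≤ M) {a b : S}
    (hne : a ≠ b)
    (hab : ∀ p : V × Equiv.Perm S, F (p.1 + (p.2 a + p.2 b : V), p.2 * Equiv.swap a b) = F p) :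
    Fintype.card (Equiv.Perm S) * ∑ u ∈ S, ∑ w ∈ S, ∑ x,
      (permMean F (x + u + w) - permMean F x) ^ 2 ≤ (#S : ℝ) ^ 2 * (9 * M ^ 2) := by
  set Φ : S → S → ℝ := fun u w => ∑ x, (permMean F (x + (u + w : V)) - permMean F x) ^ 2 with hΦ
  have hbase : ∑ π : Equiv.Perm S, Φ (π a) (π b) ≤ 9 * M ^ 2 := by
    have h := pow_le_pow_left₀ (l2norm_nonneg _) (l2norm_permMean_shift_le hM0 hM a b hab) 2
    rw [sq_l2norm, Fintype.sum_prod_type, sum_comm] at h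
    linarith
  have hpair : ∀ u w : S, ∑ π : Equiv.Perm S, Φ (π u) (π w) ≤ 9 * M ^ 2 := by
    intro u w
    rcases eq_or_ne u w with rfl | huw
    · simp only [hΦ, ZModModule.add_self, add_zero, sub_self]
      simp only [ne_eq, OfNat.ofNat_ne_zero, not_false_eq_true, zero_pow, sum_const_zero]
      positivity
    · obtain ⟨σ, hσ⟩ := Equiv.Perm.exists_extending_pair ![a, b] ![u, w]
        (by simp [Function.Injective, Fin.forall_fin_two, hne, hne.symm])
        (by simp [Function.Injective, Fin.forall_fin_two, huw, huw.symm])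
      have ha : σ a = u := hσ 0
      have hb : σ b = w := hσ 1
      rw [← ha, ← hb]
      refine le_trans (le_of_eq ?_) hbase
      exact Equiv.sum_comp (Equiv.mulRight σ) fun π : Equiv.Perm S => Φ (π a) (π b)
  have hsum : ∑ u : S, ∑ w : S, ∑ π : Equiv.Perm S, Φ (π u) (π w) =
      Fintype.card (Equiv.Perm S) * ∑ u : S, ∑ w : S, Φ u w := by
    calc _ = ∑ π : Equiv.Perm S, ∑ u : S, ∑ w : S, Φ (π u) (π w) := by
          simp_rw [fun u => sum_comm (s := univ) (t := univ) (f := fun w (π : Equiv.Perm S) =>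
            Φ (π u) (π w))]
          rw [sum_comm]
      _ = ∑ π : Equiv.Perm S, ∑ u : S, ∑ w : S, Φ u w := by
          refine sum_congr rfl fun π _ => ?_
          simp_rw [fun u => Equiv.sum_comp π fun w => Φ (π u) w]
          exact Equiv.sum_comp π fun u => ∑ w : S, Φ u w
      _ = _ := by rw [sum_const, nsmul_eq_mul, card_univ]
  have hcoe : ∑ u ∈ S, ∑ w ∈ S, ∑ x, (permMean F (x + u + w) - permMean F x) ^ 2 =
      ∑ u : S, ∑ w : S, Φ u w := by
    rw [← sum_coe_sort S]
    refine sum_congr rfl fun u _ => ?_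
    rw [← sum_coe_sort S]
    simp only [hΦ, add_assoc]
  rw [hcoe, ← hsum]
  calc _ ≤ ∑ u : S, ∑ w : S, 9 * M ^ 2 := sum_le_sum fun u _ => sum_le_sum fun w _ => hpair u w
    _ = _ := by
      simp only [sum_const, card_univ, Fintype.card_coe, nsmul_eq_mul]
      ring

/-- A function on `V × Perm S` that is almost invariant under the permutations and under the
simultaneous shift and exchange of two labels is almost constant if the Cayley graph expands. -/
theorem exists_sum_sq_sub_le (hM0 : 0 ≤ M) (hM : ∀ ρ, permLength F ρ ≤ M) {a b : S} (hne : a ≠ b)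
    (hab : ∀ p : V × Equiv.Perm S, F (p.1 + (p.2 a + p.2 b : V), p.2 * Equiv.swap a b) = F p)
    (h0 : 0 ∉ S) {ε : ℝ} (hε : 0 < ε)
    (hS : IsExpander (SimpleGraph.addCayley (S : Set V)) ε) :
    ∃ c : ℝ, ∑ p, (F p - c) ^ 2 ≤ 11 * M ^ 2 / ε := by
  have hSne : S.Nonempty := ⟨a.1, a.2⟩
  have hε1 := le_one_of_isExpander h0 hSne hS
  have hm : (0 : ℝ) < #S := by exact_mod_cast card_pos.2 hSne
  set c : ℝ := (∑ x, permMean F x) / Fintype.card V with hc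
  set n : ℝ := ((Fintype.card (Equiv.Perm S) : ℕ) : ℝ) with hn
  have hn0 : 0 < n := by
    rw [hn]
    exact_mod_cast Fintype.card_pos
  refine ⟨c, ?_⟩
  have hh : ∑ x, (permMean F x - c) = 0 := by
    have : (Fintype.card V : ℝ) ≠ 0 := by
      exact_mod_cast Fintype.card_ne_zero
    rw [sum_sub_distrib, sum_const, nsmul_eq_mul, card_univ, hc]
    field_simp
    ring
  have h1 := sum_sq_shift_ge_of_isExpander h0 hSne hε.le hS _ hh
  simp only [sub_sub_sub_cancel_right] at h1
  have h2 := sum_sq_permMean_shift_le hM0 hM hne hab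
  have h3 : 2 * ε * (n * ∑ x, (permMean F x - c) ^ 2) ≤ 9 * M ^ 2 := by
    refine le_of_mul_le_mul_left ?_ (pow_pos hm 2)
    calc _ = n * (2 * ε * (#S : ℝ) ^ 2 * ∑ x, (permMean F x - c) ^ 2) := by ring
      _ ≤ _ := mul_le_mul_of_nonneg_left h1 hn0.le
      _ ≤ _ := h2
  have h4 : ∑ p : V × Equiv.Perm S, (F p - permMean F p.1) ^ 2 ≤ M ^ 2 := by
    rw [← sq_l2norm]
    exact pow_le_pow_left₀ (l2norm_nonneg _) (l2norm_sub_permMean_le hM0 hM) 2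
  have h5 : ∑ p : V × Equiv.Perm S, (F p - c) ^ 2 ≤
      2 * ∑ p : V × Equiv.Perm S, (F p - permMean F p.1) ^ 2 +
        2 * (n * ∑ x, (permMean F x - c) ^ 2) := by
    have h6 : n * ∑ x, (permMean F x - c) ^ 2 =
        ∑ p : V × Equiv.Perm S, (permMean F p.1 - c) ^ 2 := by
      rw [Fintype.sum_prod_type, mul_sum]
      simp only [sum_const, card_univ, nsmul_eq_mul, hn]
    rw [h6, mul_sum, mul_sum, ← sum_add_distrib]
    refine sum_le_sum fun p _ => ?_
    nlinarith [sq_nonneg ((F p - permMean F p.1) - (permMean F p.1 - c))]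
  -- The two parts give `2M² + 9M²/ε`, and `ε ≤ 1` yields the constant 11.
  rw [le_div_iff₀ hε]
  nlinarith [sq_nonneg M, mul_le_mul_of_nonneg_right h5 hε.le, mul_le_mul_of_nonneg_right h4 hε.le,
    mul_nonneg (sub_nonneg.2 hε1) (sq_nonneg M)]

end Product

end Poincare

/-! ### Expansion of the walk graph -/

section Expansion

open Finset
open scoped Classical

variable {r t : ℕ} [NeZero r] {S : Finset (Fin t → ZMod 2)}

/-- No index other than `i` distinguishes `I` from `insert i I`, so the exchange only permutes the
summands of vertex `j`. For `I = ∅` neither set contributes there. -/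
theorem permTuple_mul_swap {ι : Finset (Fin r) ↪ S} {I : Finset (Fin r)} {i j : Fin r}
    (h0 : 0 ∉ I) (hi : i ≠ 0) (hj : j ≠ i) (x : Fin t → ZMod 2) (π : Equiv.Perm S) :
    permTuple ι x (π * Equiv.swap (ι I) (ι (insert i I))) j = permTuple ι x π j := by
  refine congrArg (x + ·) (sum_equiv (Equiv.swap I (insert i I)) (fun J => ?_) fun J _ => ?_)
  · have h1 : I ∈ (avoidZero r).filter (j ∈ ·) ↔ insert i I ∈ (avoidZero r).filter (j ∈ ·) := by
      simp only [mem_filter, mem_avoidZero, mem_insert, hj, false_or, h0, hi.symm, insert_nonempty,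
        not_false_eq_true, and_true, true_and, and_iff_right_iff_imp]
      exact fun h => ⟨j, h⟩
    rcases eq_or_ne J I with rfl | hJ
    · rw [Equiv.swap_apply_left]
      exact h1
    · rcases eq_or_ne J (insert i I) with rfl | hJ'
      · rw [Equiv.swap_apply_right]
        exact h1.symm
      · rw [Equiv.swap_apply_of_ne_of_ne hJ hJ']
  · rw [Equiv.Perm.mul_apply, ι.injective.swap_apply]

/-- The label of `univ.erase 0` occurs in every vertex but `0`, so replacing it by `ι ∅` moves all
of these by the same vector, which the shift of `x` cancels. -/
theorem permTuple_shift_mul_swap {ι : Finset (Fin r) ↪ S} {j : Fin r} (hj : j ≠ 0)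
    (x : Fin t → ZMod 2) (π : Equiv.Perm S) :
    permTuple ι (x + ((π (ι (univ.erase 0))).1 + (π (ι ∅)).1))
      (π * Equiv.swap (ι (univ.erase 0)) (ι ∅)) j = permTuple ι x π j := by
  have htop : univ.erase 0 ∈ (avoidZero r).filter (j ∈ ·) := by
    simp only [mem_filter, mem_avoidZero]
    exact ⟨⟨⟨j, by simp [hj]⟩, by simp⟩, by simp [hj]⟩
  have hrest : ∀ J ∈ ((avoidZero r).filter (j ∈ ·)).erase (univ.erase 0),
      ((π * Equiv.swap (ι (univ.erase 0)) (ι ∅)) (ι J)).1 = (π (ι J)).1 := by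
    intro J hJ
    obtain ⟨hJ1, hJ2⟩ := mem_erase.1 hJ
    have hJ3 : J ≠ ∅ := by
      rintro rfl
      simp at hJ2
    rw [Equiv.Perm.mul_apply, Equiv.swap_apply_of_ne_of_ne (fun h => hJ1 (ι.injective h))
      fun h => hJ3 (ι.injective h)]
  rw [permTuple, permTuple, halfTuple, halfTuple, ← add_sum_erase _ _ htop,
    ← add_sum_erase _ (fun I => (π (ι I)).1) htop, sum_congr rfl hrest, Equiv.Perm.mul_apply,
    Equiv.swap_apply_left, add_assoc x, ← add_assoc (_ + _), add_assoc _ _ (π (ι ∅)).1,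
    ZModModule.add_self, add_zero]

/-- The `(r - 1)`-edge obtained from an edge tuple by dropping one entry. -/
def face (hr : 3 ≤ r) (hS : DistinctSums (2 ^ r) S) (ι : Finset (Fin r) ↪ S) (i : Fin r)
    (p : (Fin t → ZMod 2) × Equiv.Perm S) : KEdge (booleanHypergraph r t S) (r - 1) :=
  ⟨permTuple ι p.1 p.2 '' {i}ᶜ, by
    rw [Set.ncard_image_of_injective _ ((isEdgeTuple_permTuple p.1 p.2).injective hr hS),
      Set.ncard_compl]
    simp, Set.toFinite _, _, (isEdgeTuple_permTuple p.1 p.2).range_mem_edgeSet,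
    Set.image_subset_range _ _⟩

theorem face_eq_face {hr : 3 ≤ r} {hS : DistinctSums (2 ^ r) S} {ι : Finset (Fin r) ↪ S}
    {i : Fin r} {p q : (Fin t → ZMod 2) × Equiv.Perm S}
    (h : ∀ j, j ≠ i → permTuple ι p.1 p.2 j = permTuple ι q.1 q.2 j) :
    face hr hS ι i p = face hr hS ι i q :=
  Subtype.ext (Set.image_congr h)

theorem exists_card_cofaces_eq (hr : 3 ≤ r) (hS : DistinctSums (2 ^ r) S)
    (ι : Finset (Fin r) ↪ S) :
    ∃ D, ∀ g : KEdge (booleanHypergraph r t S) (r - 1), #(cofaces g) = D := by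
  refine ⟨#(tailStabilizer ι) / #(labelStabilizer ι), fun g => ?_⟩
  rw [← card_labelStabilizer_mul_card_cofaces hr hS g, Nat.mul_div_cancel _ card_labelStabilizer_pos]

variable {D : ℕ} {f : KEdge (booleanHypergraph r t S) (r - 1) → ℝ}

theorem mul_sum_le_sum_face (hr : 3 ≤ r) (hS : DistinctSums (2 ^ r) S) (ι : Finset (Fin r) ↪ S)
    (hD : ∀ g : KEdge (booleanHypergraph r t S) (r - 1), #(cofaces g) = D)
    {φ : KEdge (booleanHypergraph r t S) (r - 1) → ℝ} (hφ : ∀ g, 0 ≤ φ g) :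
    D * #(labelStabilizer ι) * ∑ g, φ g ≤ ∑ p, φ (face hr hS ι 0 p) := by
  rw [← sum_fiberwise univ (face hr hS ι 0), mul_sum]
  refine sum_le_sum fun g _ => ?_
  have h : ∀ p ∈ univ.filter (face hr hS ι 0 · = g), φ (face hr hS ι 0 p) = φ g := fun p hp => by
    rw [(mem_filter.1 hp).2]
  rw [sum_congr rfl h, sum_const, nsmul_eq_mul]
  refine mul_le_mul_of_nonneg_right ?_ (hφ g)
  have := le_card_tail_eq (ι := ι) hr hS g
  rw [hD g] at this
  refine le_trans (by exact_mod_cast this) (Nat.cast_le.2 (card_le_card fun p hp => ?_))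
  exact mem_filter.2 ⟨mem_univ _, Subtype.ext (mem_filter.1 hp).2⟩

theorem sum_sq_face_sub_le (hr : 3 ≤ r) (hS : DistinctSums (2 ^ r) S) (ι : Finset (Fin r) ↪ S)
    (f : KEdge (booleanHypergraph r t S) (r - 1) → ℝ) (i : Fin r) :
    ∑ p, (f (face hr hS ι i p) - f (face hr hS ι 0 p)) ^ 2 ≤
      #(labelStabilizer ι) * r ^ r * ∑ e ∈ edges (booleanHypergraph r t S),
        ∑ g : KEdge (booleanHypergraph r t S) (r - 1) with g.1 ⊆ e,
          ∑ g' : KEdge (booleanHypergraph r t S) (r - 1) with g'.1 ⊆ e, (f g - f g') ^ 2 := by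
  set Q : Set (Fin t → ZMod 2) → ℝ := fun e =>
    ∑ g : KEdge (booleanHypergraph r t S) (r - 1) with g.1 ⊆ e,
      ∑ g' : KEdge (booleanHypergraph r t S) (r - 1) with g'.1 ⊆ e, (f g - f g') ^ 2 with hQ
  have hQ0 : ∀ e, 0 ≤ Q e := fun e => sum_nonneg fun _ _ => sum_nonneg fun _ _ => sq_nonneg _
  have hmem : ∀ p j, face hr hS ι j p ∈ univ.filter
      fun g : KEdge (booleanHypergraph r t S) (r - 1) => g.1 ⊆ Set.range (permTuple ι p.1 p.2) :=
    fun p j => mem_filter.2 ⟨mem_univ _, Set.image_subset_range _ _⟩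
  have hle : ∀ p, (f (face hr hS ι i p) - f (face hr hS ι 0 p)) ^ 2 ≤
      Q (Set.range (permTuple ι p.1 p.2)) := by
    intro p
    refine le_trans ?_ (single_le_sum (f := fun g => ∑ g' : KEdge (booleanHypergraph r t S) (r - 1)
      with g'.1 ⊆ Set.range (permTuple ι p.1 p.2), (f g - f g') ^ 2)
      (fun _ _ => sum_nonneg fun _ _ => sq_nonneg _) (hmem p i))
    exact single_le_sum (f := fun g' => (f (face hr hS ι i p) - f g') ^ 2)
      (fun _ _ => sq_nonneg _) (hmem p 0)
  refine (sum_le_sum fun p _ => hle p).trans ?_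
  rw [← sum_fiberwise_of_maps_to (t := edges (booleanHypergraph r t S))
    (g := fun p : (Fin t → ZMod 2) × Equiv.Perm S => Set.range (permTuple ι p.1 p.2))
    (fun p _ => mem_edges.2 (isEdgeTuple_permTuple p.1 p.2).range_mem_edgeSet), mul_sum]
  refine sum_le_sum fun e he => ?_
  have h : ∀ p ∈ univ.filter fun p : (Fin t → ZMod 2) × Equiv.Perm S =>
      Set.range (permTuple ι p.1 p.2) = e, Q (Set.range (permTuple ι p.1 p.2)) = Q e :=
    fun p hp => by rw [(mem_filter.1 hp).2]
  rw [sum_congr rfl h, sum_const, nsmul_eq_mul]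
  refine mul_le_mul_of_nonneg_right ?_ (hQ0 e)
  exact_mod_cast card_range_eq_le hr hS (mem_edges.1 he)

/-- A Poincaré inequality for functions on the `(r - 1)`-edges in terms of their variation between
the faces of a common edge. -/
theorem exists_sum_sq_face_sub_le (hr : 3 ≤ r) (hS : DistinctSums (2 ^ r) S)
    (ι : Finset (Fin r) ↪ S) (f : KEdge (booleanHypergraph r t S) (r - 1) → ℝ) {R : ℝ}
    (hR : ∀ i, ∑ p, (f (face hr hS ι i p) - f (face hr hS ι 0 p)) ^ 2 ≤ R) (h0 : 0 ∉ S) {ε : ℝ}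
    (hε : 0 < ε)
    (hexp : IsExpander (SimpleGraph.addCayley (S : Set (Fin t → ZMod 2))) ε) :
    ∃ c : ℝ, ∑ p, (f (face hr hS ι 0 p) - c) ^ 2 ≤ 11 * (12 * r * 2 ^ r) ^ 2 * R / ε := by
  set F : Fin r → (Fin t → ZMod 2) × Equiv.Perm S → ℝ := fun i p => f (face hr hS ι i p) with hF
  have hR0 : 0 ≤ R := (sum_nonneg fun _ _ => sq_nonneg _).trans (hR 0)
  have hdist : ∀ i, l2norm (F i - F 0) ≤ √R := fun i => Real.sqrt_le_sqrt (hR i)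
  have hM : ∀ ρ, permLength (F 0) ρ ≤ 6 * r * 2 ^ r * (2 * √R) := by
    refine length_le_of_hypercube (ι := ι) (permLength_mul_le _) (by positivity) ?_ ?_
    · intro ρ hρ
      have hinv : ∀ p, F 0 (p.1, p.2 * ρ) = F 0 p := fun p => by
        refine congrArg f (face_eq_face fun j _ => ?_)
        exact congrFun (permTuple_mul_of_mem_labelStabilizer
          (mem_filter.2 ⟨mem_univ _, hρ⟩) p.1 p.2) j
      simpa [l2norm] using permLength_le_of_invariant (F 0) (F 0) hinv
    · intro I i hI hi _
      refine (permLength_le_of_invariant (F 0) (F i) fun p => ?_).trans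
        (mul_le_mul_of_nonneg_left (hdist i) zero_le_two)
      exact congrArg f (face_eq_face fun j hj => permTuple_mul_swap hI hi hj p.1 p.2)
  have hne : ι (univ.erase 0) ≠ ι ∅ := by
    refine fun h => ?_
    have h1 : (univ : Finset (Fin r)).erase 0 = ∅ := ι.injective h
    have h2 := congrArg card h1
    rw [card_erase_of_mem (mem_univ _), card_univ, Fintype.card_fin, card_empty] at h2
    omega
  obtain ⟨c, hc⟩ := exists_sum_sq_sub_le (by positivity) hM hne
    (fun p => congrArg f (face_eq_face fun j hj => permTuple_shift_mul_swap hj p.1 p.2)) h0 hε hexp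
  refine ⟨c, hc.trans (le_of_eq ?_)⟩
  rw [mul_pow, mul_pow _ √R, Real.sq_sqrt hR0]
  ring

theorem card_le_mul_sub_eigenvalue (hr : 3 ≤ r) (hS : DistinctSums (2 ^ r) S)
    (ι : Finset (Fin r) ↪ S)
    (hD : ∀ g : KEdge (booleanHypergraph r t S) (r - 1), #(cofaces g) = D) (h0 : 0 ∉ S) {ε : ℝ}
    (hε : 0 < ε)
    (hexp : IsExpander (SimpleGraph.addCayley (S : Set (Fin t → ZMod 2))) ε) {μ : ℝ}
    (hf0 : f ≠ 0) (hsum : ∑ g, f g = 0)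
    (hf : ((walkGraph (booleanHypergraph r t S) r).adjMatrix ℝ).mulVec f = μ • f) :
    ε * D ≤ 22 * (12 * r * 2 ^ r) ^ 2 * r ^ r * ((r - 1) * D - μ) := by
  have hU := booleanHypergraph_isUniform hr hS
  set q := ∑ g, f g ^ 2 with hq
  have hq0 : 0 < q := by
    obtain ⟨g, hg⟩ := Function.ne_iff.1 hf0
    exact sum_pos' (fun _ _ => sq_nonneg _) ⟨g, mem_univ _, sq_pos_of_ne_zero hg⟩
  set W : ℝ := ((#(labelStabilizer ι) : ℕ) : ℝ) with hW
  have hW0 : 0 < W := by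
    rw [hW]
    exact_mod_cast card_labelStabilizer_pos
  obtain ⟨c, hc⟩ := exists_sum_sq_face_sub_le hr hS ι f (sum_sq_face_sub_le hr hS ι f) h0 hε hexp
  rw [sum_sq_sub_faces (by omega) hU hD hf, le_div_iff₀ hε] at hc
  have h1 := mul_sum_le_sum_face hr hS ι hD (φ := fun g => (f g - c) ^ 2) fun _ => sq_nonneg _
  -- As `f` has mean zero, subtracting a constant cannot decrease its norm.
  have h2 : q ≤ ∑ g, (f g - c) ^ 2 := by
    simp only [sub_sq, sum_add_distrib, sum_sub_distrib, ← mul_sum, ← sum_mul, hsum]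
    have : 0 ≤ ∑ _g : KEdge (booleanHypergraph r t S) (r - 1), c ^ 2 :=
      sum_nonneg fun _ _ => sq_nonneg _
    linarith
  have h3 : D * W * q ≤ ∑ p, (f (face hr hS ι 0 p) - c) ^ 2 :=
    (mul_le_mul_of_nonneg_left h2 (by positivity)).trans h1
  have h4 := (mul_le_mul_of_nonneg_right h3 hε.le).trans hc
  refine le_of_mul_le_mul_right ?_ (mul_pos hW0 hq0)
  linarith

end Expansion

end HypergraphExpander

open HypergraphExpander in
theorem theorem1 (r : ℕ) (hr : 3 ≤ r) :
    ∃ c : ℝ, 0 < c ∧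
      ∀ (t : ℕ) (ε : ℝ) (S : Finset (Fin t → ZMod 2)),
        0 < ε →
        2 ^ (2 * r) ≤ S.card →
        HypergraphExpander.DistinctSums (2 ^ r) S →
        HypergraphExpander.IsExpander
          (SimpleGraph.addCayley (S : Set (Fin t → ZMod 2))) ε →
        HypergraphExpander.IsExpander
          (HypergraphExpander.walkGraph (HypergraphExpander.booleanHypergraph r t S) r)
          (c * ε) := by
  have : NeZero r := ⟨by omega⟩
  have hr' : (3 : ℝ) ≤ r := by exact_mod_cast hr
  set C : ℝ := 22 * (12 * r * 2 ^ r) ^ 2 * r ^ r with hC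
  have hC1 : 1 ≤ C := by
    have h1 : (1 : ℝ) ≤ 2 ^ r := one_le_pow₀ (by norm_num)
    have h2 : (1 : ℝ) ≤ (r : ℝ) ^ r := one_le_pow₀ (by linarith)
    have h3 : (1 : ℝ) ≤ (12 * r * 2 ^ r) ^ 2 := one_le_pow₀ (by nlinarith)
    nlinarith [mul_le_mul h3 h2 zero_le_one (by positivity)]
  -- `C` comes from `card_le_mul_sub_eigenvalue`; the factor `r` pays for the degree `(r-1)D` in
  -- place of `D`.
  refine ⟨1 / (C * r), by positivity, fun t ε S hε hcard hS hexp => ?_⟩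
  have h0 : 0 ∉ S := fun h => by
    have := hS {0} (by simpa using h) ∅ (by simp) (by simpa using Nat.one_le_two_pow) (by simp)
      (by simp)
    simp at this
  have hle : 2 ^ r ≤ S.card := (Nat.pow_le_pow_right two_pos (by omega)).trans hcard
  have hne : S.Nonempty := Finset.card_pos.1 (lt_of_lt_of_le (by positivity) hle)
  have hε1 := le_one_of_isExpander h0 hne hexp
  obtain ⟨ι⟩ : Nonempty (Finset (Fin r) ↪ S) :=
    Function.Embedding.nonempty_of_card_le (by simpa using hle)
  obtain ⟨D, hD⟩ := exists_card_cofaces_eq hr hS ι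
  have hU := booleanHypergraph_isUniform hr hS
  refine ⟨(r - 1) * D, walkGraph_isRegular (by omega) hU hD, ?_⟩
  rintro μ ⟨f, hf0, hsum, hf⟩
  have hupper := card_le_mul_sub_eigenvalue hr hS ι hD h0 hε hexp hf0 hsum hf
  have hlower : 0 ≤ D + μ := by
    have h1 := sum_sq_sum_faces (by omega) hU hD hf
    have h2 : 0 ≤ (D + μ) * ∑ g, f g ^ 2 := h1 ▸ Finset.sum_nonneg fun _ _ => sq_nonneg _
    obtain ⟨g, hg⟩ := Function.ne_iff.1 hf0
    exact nonneg_of_mul_nonneg_left h2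
      (Finset.sum_pos' (fun _ _ => sq_nonneg _) ⟨g, Finset.mem_univ _, sq_pos_of_ne_zero hg⟩)
  have hcast : (((r - 1) * D : ℕ) : ℝ) = (r - 1) * D := by
    push_cast [Nat.cast_sub (show 1 ≤ r by omega)]
    ring
  rw [hcast]
  have hD0 : (0 : ℝ) ≤ D := Nat.cast_nonneg D
  have hd0 : 2 * (D : ℝ) ≤ (r - 1) * D := by nlinarith
  have hgap : 1 / (C * r) * ε * ((r - 1) * D) ≤ (r - 1) * D - μ := by
    have h1 : 1 / (C * r) * ε * ((r - 1) * D) ≤ 1 / (C * r) * ε * (r * D) := by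
      gcongr
      linarith
    have h2 : 1 / (C * r) * ε * (r * D) = ε * D / C := by field_simp
    rw [h2] at h1
    refine h1.trans ((div_le_iff₀ (by positivity)).2 ?_)
    linarith
  have hhalf : 1 / (C * r) * ε ≤ 1 / 2 := by
    have h1 : 1 / (C * r) ≤ 1 / 2 := one_div_le_one_div_of_le two_pos (by nlinarith)
    calc 1 / (C * r) * ε ≤ 1 / 2 * 1 := mul_le_mul h1 hε1 hε.le (by norm_num)
      _ = 1 / 2 := by norm_num
  -- From below, `μ ≥ -D ≥ -(r-1)D/2` by `r ≥ 3`, which suffices since `cε ≤ 1/2`.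
  rw [abs_le]
  constructor
  · nlinarith [mul_le_mul_of_nonneg_right hhalf (by linarith : 0 ≤ ((r : ℝ) - 1) * D)]
  · linarith
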